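/- Let $H$ be a separable complex Hilbert space and let $A$ be a self-adjoint operator in $H$ with $A\ge\lambda_0 E$ for some $\lambda_0>0$, where $E$ is the identity operator. For $\kappa\in\mathbb R$ let $L_{2,\kappa}(\mathbb R_+;H)$ be the space of (classes of) measurable functions $f:\mathbb R_+=[0,\infty)\to H$ with finite norm $$\|f\|_{L_{2,\kappa}}=\Big(\int_0^\infty\|f(t)\|_H^2\,e^{-\kappa t}\,dt\Big)^{1/2},$$ let $W^4_{2,\kappa}(\mathbb R_+;H)$ be the space of all functions $u$ with $\frac{d^4u}{dt^4}\in L_{2,\kappa}(\mathbb R_+;H)$ (derivative in the sense of generalized functions) and $A^4u\in L_{2,\kappa}(\mathbb R_+;H)$, with the norm $$\|u\|_{W^4_{2,\kappa}}=\Big(\Big\|\frac{d^4u}{dt^4}\Big\|_{L_{2,\kappa}}^2+\|A^4u\|_{L_{2,\kappa}}^2\Big)^{1/2},$$ and let $\overset{\circ}{W}{}^4_{2,\kappa}(\mathbb R_+;H)$ be its subspace of all $u$ with $u(0)=u'(0)=u''(0)=0$. If $|\kappa|<2\lambda_0$, then the operator $$P_0u=\Big(-\frac{d}{dt}+A\Big)\Big(\frac{d}{dt}+A\Big)^3u$$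 is defined on all of $\overset{\circ}{W}{}^4_{2,\kappa}(\mathbb R_+;H)$ and maps this space isomorphically onto $L_{2,\kappa}(\mathbb R_+;H)$; that is, it is a bounded linear bijection between these spaces with bounded inverse. -/

import Mathlib

open MeasureTheory Set Filter Topology
open scoped ContDiff ENNReal

noncomputable section

namespace WeightedODE

/-! ### Partially defined operators -/

section Operators

variable {E : Type*} [AddCommGroup E] [Module ℂ E]

/-- Product `g f` of two partially defined operators, with its natural domain
`{x ∈ D(f) | f x ∈ D(g)}`. -/
def opComp (g f : E →ₗ.[ℂ] E) : E →ₗ.[ℂ] E where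
  domain := (g.domain.comap f.toFun).map f.domain.subtype
  toFun :=
    { toFun := fun x => g ⟨f ⟨x.1, by
          obtain ⟨y, _, hyx⟩ := x.2
          exact hyx ▸ y.2⟩, by
          obtain ⟨x, y, hy, rfl⟩ := x
          exact hy⟩
      map_add' := fun x y => by
        rw [← g.map_add]
        congr 1
        ext
        simp only [Submodule.coe_add]
        rw [← f.map_add]
        rfl
      map_smul' := fun c x => by
        rw [RingHom.id_apply, ← g.map_smul]
        congr 1
        ext
        simp only [Submodule.coe_smul]
        rw [← f.map_smul]
        rfl }

/-- Powers of a partially defined operator: `T ^ 0 = 1` on the whole space and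
`T ^ (n + 1) = T (T ^ n)`, with natural domains. -/
def opPow (T : E →ₗ.[ℂ] E) : ℕ → (E →ₗ.[ℂ] E)
  | 0 => LinearMap.id.toPMap ⊤
  | n + 1 => opComp T (opPow T n)

theorem mem_opComp_graph (g f : E →ₗ.[ℂ] E) (x z : E) :
    (x, z) ∈ (opComp g f).graph ↔ ∃ y, (x, y) ∈ f.graph ∧ (y, z) ∈ g.graph := by
  simp only [LinearPMap.mem_graph_iff]
  constructor
  · rintro ⟨⟨_, ⟨a, ha, rfl⟩⟩, rfl, rfl⟩
    exact ⟨f a, ⟨a, rfl, rfl⟩, ⟨f a, ha⟩, rfl, rfl⟩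
  · rintro ⟨_, ⟨a, rfl, rfl⟩, ⟨b, hb, rfl⟩⟩
    have ha : f a ∈ g.domain := hb ▸ b.2
    refine ⟨⟨a.1, ⟨a, ha, rfl⟩⟩, rfl, ?_⟩
    change g ⟨f a, ha⟩ = g b
    congr 1
    exact Subtype.ext hb.symm

end Operators

/-! ### The weighted space `L_{2,κ}(ℝ₊; H)` -/

/-- The measure `e^{-κ t} dt` on the half-line `(0, ∞)`. -/
def wMeasure (κ : ℝ) : Measure ℝ :=
  (volume.restrict (Ioi 0)).withDensity fun t => ENNReal.ofReal (Real.exp (-κ * t))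

/-- `L_{2,κ}(ℝ₊; H)`, with norm `(∫₀^∞ ‖f(t)‖² e^{-κ t} dt)^{1/2}`. -/
abbrev L2w (κ : ℝ) (H : Type*) [NormedAddCommGroup H] : Type _ := Lp H 2 (wMeasure κ)

/-- Test functions: smooth, with compact support in the open half-line `(0, ∞)`. -/
def IsTest (φ : ℝ → ℝ) : Prop :=
  ContDiff ℝ ∞ φ ∧ HasCompactSupport φ ∧ tsupport φ ⊆ Ioi 0

variable {H : Type*} [NormedAddCommGroup H] [InnerProductSpace ℂ H]

theorem ae_wMeasure_iff (κ : ℝ) {p : ℝ → Prop} :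
    (∀ᵐ t ∂wMeasure κ, p t) ↔ ∀ᵐ t ∂(volume.restrict (Ioi (0 : ℝ))), p t := by
  rw [wMeasure, ae_withDensity_iff (by fun_prop)]
  simp [Real.exp_pos]

theorem integrable_smul_L2w {κ : ℝ} {ψ : ℝ → ℝ} (hψ : Continuous ψ) (hc : HasCompactSupport ψ)
    (u : L2w κ H) : Integrable (fun t => ψ t • u t) (volume.restrict (Ioi 0)) := by
  have : IsLocallyFiniteMeasure (wMeasure κ) := by
    unfold wMeasure
    exact IsLocallyFiniteMeasure.withDensity_coe
      (f := fun t => Real.toNNReal (Real.exp (-κ * t))) (by fun_prop)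
  have hχ : Continuous fun t => Real.exp (κ * t) * ψ t := by fun_prop
  have h1 : MemLp (fun t => Real.exp (κ * t) * ψ t) 2 (wMeasure κ) :=
    hχ.memLp_of_hasCompactSupport hc.mul_left
  suffices key : ∀ f : ℝ → H, MemLp f 2 (wMeasure κ) →
      Integrable (fun t => ψ t • f t) (volume.restrict (Ioi 0)) from key _ (Lp.memLp u)
  intro f hu
  have h2 : Integrable (fun t => (Real.exp (κ * t) * ψ t) • f t) (wMeasure κ) :=
    memLp_one_iff_integrable.mp (MemLp.smul (𝕜 := ℝ) (p := 2) (q := 2) (r := 1) hu h1)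
  have hm : Measurable fun t : ℝ => ENNReal.ofReal (Real.exp (-κ * t)) := by fun_prop
  rw [wMeasure, integrable_withDensity_iff_integrable_smul' hm (by simp)] at h2
  refine h2.congr (ae_of_all _ fun t => ?_)
  simp only [ENNReal.toReal_ofReal (Real.exp_pos _).le, smul_smul]
  rw [← mul_assoc, ← Real.exp_add]
  simp

/-! ### Generalized derivatives in `L_{2,κ}(ℝ₊; H)` -/

theorem IsTest.continuous_iteratedDeriv {φ : ℝ → ℝ} (h : IsTest φ) (n : ℕ) :
    Continuous (iteratedDeriv n φ) :=
  h.1.continuous_iteratedDeriv n (mod_cast le_top)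

theorem IsTest.hasCompactSupport_iteratedDeriv {φ : ℝ → ℝ} (h : IsTest φ) (n : ℕ) :
    HasCompactSupport (iteratedDeriv n φ) := by
  induction n with
  | zero => simpa using h.2.1
  | succ n ih => rw [iteratedDeriv_succ]; exact ih.deriv

/-- Pairs `(u, g)` in `L_{2,κ}` such that `g` is the `n`-th derivative of `u` on `(0, ∞)` in the
sense of generalized functions: `∫ φ⁽ⁿ⁾ u = (-1)ⁿ ∫ φ g` for all test functions `φ`. -/
def weakDerivGraph (κ : ℝ) (H : Type*) [NormedAddCommGroup H] [InnerProductSpace ℂ H] (n : ℕ) :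
    Submodule ℂ (L2w κ H × L2w κ H) where
  carrier := {p | ∀ φ : ℝ → ℝ, IsTest φ →
    ∫ t in Ioi 0, iteratedDeriv n φ t • p.1 t = (-1 : ℝ) ^ n • ∫ t in Ioi 0, φ t • p.2 t}
  zero_mem' := fun φ _ => by
    have h : ∀ ψ : ℝ → ℝ, ∫ t in Ioi 0, ψ t • (0 : L2w κ H) t = 0 := fun ψ => by
      rw [← integral_zero (α := ℝ) (G := H) (μ := volume.restrict (Ioi 0))]
      refine integral_congr_ae ?_
      filter_upwards [(ae_wMeasure_iff κ).mp (Lp.coeFn_zero H 2 (wMeasure κ))] with t ht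
      rw [ht, Pi.zero_apply, smul_zero]
    rw [Prod.fst_zero, Prod.snd_zero, h, h, smul_zero]
  add_mem' := fun {p q} hp hq φ hφ => by
    have h : ∀ (ψ : ℝ → ℝ) (v w : L2w κ H), Continuous ψ → HasCompactSupport ψ →
        ∫ t in Ioi 0, ψ t • (v + w) t
          = (∫ t in Ioi 0, ψ t • v t) + ∫ t in Ioi 0, ψ t • w t := fun ψ v w hψ hc => by
      rw [← integral_add (integrable_smul_L2w hψ hc v) (integrable_smul_L2w hψ hc w)]
      refine integral_congr_ae ?_
      filter_upwards [(ae_wMeasure_iff κ).mp (Lp.coeFn_add v w)] with t ht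
      rw [ht, Pi.add_apply, smul_add]
    rw [Prod.fst_add, Prod.snd_add,
      h _ _ _ (hφ.continuous_iteratedDeriv n) (hφ.hasCompactSupport_iteratedDeriv n),
      h _ _ _ hφ.1.continuous hφ.2.1, smul_add, hp φ hφ, hq φ hφ]
  smul_mem' := fun c p hp φ hφ => by
    have h : ∀ (ψ : ℝ → ℝ) (v : L2w κ H),
        ∫ t in Ioi 0, ψ t • (c • v) t = c • ∫ t in Ioi 0, ψ t • v t := fun ψ v => by
      rw [← integral_smul]
      refine integral_congr_ae ?_
      filter_upwards [(ae_wMeasure_iff κ).mp (Lp.coeFn_smul c v)] with t ht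
      simp only [ht, Pi.smul_apply]
      rw [smul_comm]
    rw [Prod.smul_fst, Prod.smul_snd, h, h, hp φ hφ, smul_comm]

/-- The operator `dⁿ/dtⁿ` in `L_{2,κ}(ℝ₊; H)`, with domain all `u` whose generalized `n`-th
derivative is in `L_{2,κ}`. -/
def weakDeriv (κ : ℝ) (H : Type*) [NormedAddCommGroup H] [InnerProductSpace ℂ H] (n : ℕ) :
    L2w κ H →ₗ.[ℂ] L2w κ H :=
  (weakDerivGraph κ H n).toLinearPMap

/-- The operator `u ↦ T u(·)` in `L_{2,κ}(ℝ₊; H)`: pairs `(u, h)` with `u(t) ∈ D(T)` and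
`h(t) = T u(t)` for almost every `t`. -/
def pointwiseGraph (κ : ℝ) (T : H →ₗ.[ℂ] H) : Submodule ℂ (L2w κ H × L2w κ H) where
  carrier := {p | ∀ᵐ t ∂wMeasure κ, (p.1 t, p.2 t) ∈ T.graph}
  zero_mem' := by
    change ∀ᵐ t ∂wMeasure κ, _
    filter_upwards [Lp.coeFn_zero H 2 (wMeasure κ)] with t ht
    rw [Prod.fst_zero, Prod.snd_zero, ht]
    exact T.graph.zero_mem
  add_mem' := fun {p q} hp hq => by
    change ∀ᵐ t ∂wMeasure κ, _
    filter_upwards [hp, hq, Lp.coeFn_add p.1 q.1, Lp.coeFn_add p.2 q.2] with t h1 h2 h3 h4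
    rw [Prod.fst_add, Prod.snd_add, h3, h4]
    exact T.graph.add_mem h1 h2
  smul_mem' := fun c p hp => by
    change ∀ᵐ t ∂wMeasure κ, _
    filter_upwards [hp, Lp.coeFn_smul c p.1, Lp.coeFn_smul c p.2] with t h1 h3 h4
    rw [Prod.smul_fst, Prod.smul_snd, h3, h4]
    exact T.graph.smul_mem c h1

/-- The operator `u ↦ T u(·)` in `L_{2,κ}(ℝ₊; H)`, with its maximal domain. -/
def pointwiseOp (κ : ℝ) (T : H →ₗ.[ℂ] H) : L2w κ H →ₗ.[ℂ] L2w κ H :=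
  (pointwiseGraph κ T).toLinearPMap

/-- The graph of `weakDeriv` is the defining relation: generalized derivatives are unique. -/
theorem weakDeriv_graph [CompleteSpace H] (κ : ℝ) (n : ℕ) :
    (weakDeriv κ H n).graph = weakDerivGraph κ H n := by
  refine Submodule.toLinearPMap_graph_eq _ ?_
  rintro ⟨u, g⟩ hp (rfl : u = 0)
  have h0 : ∀ ψ : ℝ → ℝ, ∫ t in Ioi 0, ψ t • (0 : L2w κ H) t = 0 := fun ψ => by
    rw [← integral_zero (α := ℝ) (G := H) (μ := volume.restrict (Ioi 0))]
    refine integral_congr_ae ?_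
    filter_upwards [(ae_wMeasure_iff κ).mp (Lp.coeFn_zero H 2 (wMeasure κ))] with t ht
    rw [ht, Pi.zero_apply, smul_zero]
  have hg : ∀ φ : ℝ → ℝ, IsTest φ → ∫ t in Ioi 0, φ t • g t = 0 := fun φ hφ => by
    have := hp φ hφ
    rw [h0] at this
    simpa using this.symm
  have hloc : LocallyIntegrableOn (fun t => g t) (Ioi (0 : ℝ)) := by
    rw [locallyIntegrableOn_iff isOpen_Ioi.isLocallyClosed]
    intro K hK hKc
    obtain ⟨ψ, hψ1, -, hψc, -⟩ := exists_continuous_one_zero_of_isCompact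
      (X := ℝ) hKc isClosed_empty (disjoint_empty K)
    have hi := integrable_smul_L2w ψ.continuous hψc g
    have hi' : IntegrableOn (fun t => ψ t • g t) K volume := IntegrableOn.mono_set hi hK
    exact hi'.congr_fun (fun t ht => by simp [hψ1 ht]) hKc.measurableSet
  have hae : ∀ᵐ t : ℝ, t ∈ Ioi (0 : ℝ) → g t = 0 :=
    isOpen_Ioi.ae_eq_zero_of_integral_contDiff_smul_eq_zero hloc fun φ hφ hc hs => by
      rw [← hg φ ⟨hφ, hc, hs⟩]
      refine (setIntegral_eq_integral_of_forall_compl_eq_zero fun t ht => ?_).symm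
      rw [image_eq_zero_of_notMem_tsupport fun h => ht (hs h), zero_smul]
  rw [← ae_restrict_iff' measurableSet_Ioi, ← ae_wMeasure_iff κ] at hae
  exact (Lp.eq_zero_iff_ae_eq_zero).mpr hae

/-- The graph of `pointwiseOp` is the defining relation. -/
theorem pointwiseOp_graph (κ : ℝ) (T : H →ₗ.[ℂ] H) :
    (pointwiseOp κ T).graph = pointwiseGraph κ T := by
  refine Submodule.toLinearPMap_graph_eq _ ?_
  rintro ⟨u, g⟩ hp (rfl : u = 0)
  refine (Lp.eq_zero_iff_ae_eq_zero).mpr ?_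
  filter_upwards [hp, Lp.coeFn_zero H 2 (wMeasure κ)] with t h1 h2
  rw [h2] at h1
  exact T.graph_fst_eq_zero_snd h1 rfl

/-! ### The spaces `W⁴_{2,κ}(ℝ₊; H)` -/

/-- `W⁴_{2,κ}(ℝ₊; H)`: all `u` with `d⁴u/dt⁴ ∈ L_{2,κ}` and `A⁴ u ∈ L_{2,κ}`. A separate type,
since its norm is not the one of `L_{2,κ}`. -/
def W4 (A : H →ₗ.[ℂ] H) (κ : ℝ) : Type _ :=
  ↥((weakDeriv κ H 4).domain ⊓ (pointwiseOp κ (opPow A 4)).domain)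

instance (A : H →ₗ.[ℂ] H) (κ : ℝ) : AddCommGroup (W4 A κ) :=
  inferInstanceAs (AddCommGroup
    ↥((weakDeriv κ H 4).domain ⊓ (pointwiseOp κ (opPow A 4)).domain))

instance (A : H →ₗ.[ℂ] H) (κ : ℝ) : Module ℂ (W4 A κ) :=
  inferInstanceAs (Module ℂ
    ↥((weakDeriv κ H 4).domain ⊓ (pointwiseOp κ (opPow A 4)).domain))

namespace W4

variable {A : H →ₗ.[ℂ] H} {κ : ℝ}

/-- The underlying element of `L_{2,κ}`. -/
def toL2 : W4 A κ →ₗ[ℂ] L2w κ H :=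
  Submodule.subtype ((weakDeriv κ H 4).domain ⊓ (pointwiseOp κ (opPow A 4)).domain)

/-- The generalized fourth derivative `d⁴u/dt⁴`. -/
def d4 : W4 A κ →ₗ[ℂ] L2w κ H :=
  (weakDeriv κ H 4).toFun ∘ₗ Submodule.inclusion inf_le_left

/-- The function `A⁴ u`. -/
def a4 : W4 A κ →ₗ[ℂ] L2w κ H :=
  (pointwiseOp κ (opPow A 4)).toFun ∘ₗ Submodule.inclusion inf_le_right

/-- `u ↦ (d⁴u/dt⁴, A⁴ u)`. -/
def pair : W4 A κ →ₗ[ℂ] WithLp 2 (L2w κ H × L2w κ H) :=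
  (WithLp.linearEquiv 2 ℂ (L2w κ H × L2w κ H)).symm.toLinearMap ∘ₗ d4.prod a4

/-- The norm `(‖d⁴u/dt⁴‖² + ‖A⁴ u‖²)^{1/2}`. -/
instance : SeminormedAddCommGroup (W4 A κ) :=
  SeminormedAddCommGroup.induced (W4 A κ) (WithLp 2 (L2w κ H × L2w κ H)) pair

instance : NormedSpace ℂ (W4 A κ) :=
  NormedSpace.induced ℂ (W4 A κ) (WithLp 2 (L2w κ H × L2w κ H)) pair

theorem norm_eq (u : W4 A κ) : ‖u‖ = Real.sqrt (‖d4 u‖ ^ 2 + ‖a4 u‖ ^ 2) :=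
  WithLp.prod_norm_eq_of_L2 (pair u)

end W4

/-- The subspace of `W⁴_{2,κ}(ℝ₊; H)` given by `u(0) = u'(0) = u''(0) = 0`: the values at `0` are
those of the representative of `u` that is twice continuously differentiable on `[0, ∞)`. -/
def W40 (A : H →ₗ.[ℂ] H) (κ : ℝ) : Submodule ℂ (W4 A κ) where
  carrier := {u | ∃ w : ℝ → H, w =ᵐ[wMeasure κ] W4.toL2 u ∧ ContDiffOn ℝ 2 w (Ici 0) ∧
    ∀ s : ℕ, s ≤ 2 → iteratedDerivWithin s w (Ici 0) 0 = 0}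
  zero_mem' := by
    refine ⟨0, ?_, contDiffOn_const, fun s _ => ?_⟩
    · rw [map_zero]
      exact (Lp.coeFn_zero H 2 (wMeasure κ)).symm
    · change iteratedDerivWithin s (fun _ => (0 : H)) (Ici 0) 0 = 0
      simp
  add_mem' := by
    rintro u v ⟨w, hw, hwc, hw0⟩ ⟨z, hz, hzc, hz0⟩
    refine ⟨w + z, ?_, hwc.add hzc, fun s hs => ?_⟩
    · rw [map_add]
      filter_upwards [hw, hz, Lp.coeFn_add (W4.toL2 u) (W4.toL2 v)] with t h1 h2 h3
      rw [h3, Pi.add_apply, Pi.add_apply, h1, h2]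
    · have hs' : (s : WithTop ℕ∞) ≤ 2 := mod_cast hs
      have h0 : (0 : ℝ) ∈ Ici (0 : ℝ) := self_mem_Ici
      rw [iteratedDerivWithin_add h0 (uniqueDiffOn_Ici 0) ((hwc.of_le hs') 0 h0)
        ((hzc.of_le hs') 0 h0), hw0 s hs, hz0 s hs, add_zero]
  smul_mem' := by
    rintro c u ⟨w, hw, hwc, hw0⟩
    refine ⟨c • w, ?_, hwc.const_smul c, fun s hs => ?_⟩
    · rw [map_smul]
      filter_upwards [hw, Lp.coeFn_smul c (W4.toL2 u)] with t h1 h3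
      rw [h3, Pi.smul_apply, Pi.smul_apply, h1]
    · have hs' : (s : WithTop ℕ∞) ≤ 2 := mod_cast hs
      have h0 : (0 : ℝ) ∈ Ici (0 : ℝ) := self_mem_Ici
      rw [iteratedDerivWithin_const_smul h0 (uniqueDiffOn_Ici 0) c ((hwc.of_le hs') 0 h0),
        hw0 s hs, smul_zero]

/-- The operator `(-d/dt + A)(d/dt + A)³` in `L_{2,κ}(ℝ₊; H)`, with its natural domain. -/
def P0 (A : H →ₗ.[ℂ] H) (κ : ℝ) : L2w κ H →ₗ.[ℂ] L2w κ H :=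
  opComp (-weakDeriv κ H 1 + pointwiseOp κ A) (opPow (weakDeriv κ H 1 + pointwiseOp κ A) 3)

end WeightedODE

end

open MeasureTheory Set Filter Topology
open scoped ContDiff ENNReal

noncomputable section

namespace WeightedODE

section

/-! ### Bounded operators in a Hilbert space -/

section Abstract

variable {X : Type*} [NormedAddCommGroup X] [InnerProductSpace ℂ X]

/-! The two first-order factors are inverted separately in L_{2,κ}. Let B = A⁻¹, which is bounded
and acts pointwise in t. Write A = λ₀ + (A - λ₀) with A - λ₀ ≥ 0. With zero initial value, d/dt + ν
has a bounded accretive inverse as soon as 2ν + κ > 0 (`energy_volterraFun`). In the weighted inner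
product -d/dt + λ₀ arises as the adjoint of d/dt + (λ₀ - κ), so its inverse is bounded and accretive
when 2λ₀ - κ > 0, with no initial condition. An accretive operator in t can be added to the
commuting positive operator A - λ₀ (`IsPosInverse.exists_resolvent`). This gives R' = (d/dt + A)⁻¹
with zero initial value and R = (-d/dt + A)⁻¹, together with bounded S' = A R' and S = A R; the two
conditions on κ amount to |κ| < 2λ₀.

Domain and boundedness of P₀: on functions with a weak derivative, R d/dt = S - 1, and R A = S.
Hence R⁴ u'''' = (S - 1)⁴ u and R⁴ A⁴ u = S⁴ u. The polynomials S⁴ and (S - 1)⁴ are coprime, so a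
Bezout identity (`eq_pow_apply`) yields u = R⁴ h with h a bounded function of the pair (u'''', A⁴
u). On such u all factors of P₀ apply, and P₀ u = Z³ h with Z = (d/dt + A) R = 2S - 1
(`mem_P0_graph_backward`). The intermediate derivatives are obtained by the same identity with the
scalar m in place of A (`exists_weakDeriv_chain`).

Surjectivity: u = R'³ R f solves P₀ u = f, lies in W⁴ with norm controlled by f, and vanishes to
second order at 0 (`exists_solution`).

Injectivity: P₀ u = 0 gives (d/dt + A)³ u = R P₀ u = 0, and the three zero initial values allow R'
to recover u from this in three steps (`eq_zero_of_P0_eq_zero`). -/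

/-- A bounded inverse of an operator `A ≥ m > 0`: symmetric, injective, `m ‖B y‖² ≤ ⟪B y, y⟫`, and
with the square roots of `B - m B²` and `1 - m B`. -/
structure IsPosInverse (B J Q : X →L[ℂ] X) (m : ℝ) : Prop where
  symm : ∀ x y, inner ℂ (B x) y = inner ℂ x (B y)
  inj : ∀ x, B x = 0 → x = 0
  symmJ : ∀ x y, inner ℂ (J x) y = inner ℂ x (J y)
  symmQ : ∀ x y, inner ℂ (Q x) y = inner ℂ x (Q y)
  sqJ : ∀ x, J (J x) = B x - (m : ℂ) • B (B x)
  sqQ : ∀ x, Q (Q x) = x - (m : ℂ) • B x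

theorem re_inner_self (x : X) : (inner ℂ x x).re = ‖x‖ ^ 2 :=
  inner_self_eq_norm_sq (𝕜 := ℂ) x

namespace IsPosInverse

variable {B J Q V : X →L[ℂ] X} {m : ℝ}

theorem le_re_inner (h : IsPosInverse B J Q m) (x : X) :
    m * ‖B x‖ ^ 2 ≤ (inner ℂ (B x) x).re := by
  have h1 : (inner ℂ (J (J x)) x).re = ‖J x‖ ^ 2 := by
    rw [h.symmJ, re_inner_self]
  rw [h.sqJ, inner_sub_left, inner_smul_left, h.symm (B x) x, Complex.conj_ofReal, Complex.sub_re,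
    Complex.re_ofReal_mul, re_inner_self] at h1
  linarith [sq_nonneg ‖J x‖]

/-- If `B x + (1 - m B) V x = 0` with `V` accretive, then `x = 0`. -/
theorem eq_zero_of_add_eq_zero (h : IsPosInverse B J Q m) (hm : 0 < m)
    (hV : ∀ x, 0 ≤ (inner ℂ (V x) x).re) (hQV : ∀ x, Q (V x) = V (Q x)) {x : X}
    (hx : B x + (V x - (m : ℂ) • B (V x)) = 0) : x = 0 := by
  have h1 : (inner ℂ (B x + (V x - (m : ℂ) • B (V x))) x).re = 0 := by rw [hx]; simp
  -- The second summand is Q² V x; moving one Q across and commuting the other past V turns it into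
  -- the accretive form of V at Q x.
  rw [← h.sqQ, inner_add_left, h.symmQ, hQV, Complex.add_re] at h1
  have h2 := h.le_re_inner x
  have h3 := hV (Q x)
  have h4 : ‖B x‖ ^ 2 = 0 := by nlinarith [mul_nonneg hm.le (sq_nonneg ‖B x‖), sq_nonneg ‖B x‖]
  exact h.inj x (by simpa using h4)

/-- Uniqueness for N w + (A - m) w = f, with n = N y and a = A y. The defect d = a - S f satisfies B
d = y - R f = V (m B d - d), that is B d + (1 - m B) V d = 0, which forces d = 0. -/
theorem resolvent_apply (h : IsPosInverse B J Q m) (hm : 0 < m)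
    (hV : ∀ x, 0 ≤ (inner ℂ (V x) x).re) (hQV : ∀ x, Q (V x) = V (Q x))
    (hBV : ∀ x, B (V x) = V (B x))
    {R S : X →L[ℂ] X} (hR : ∀ f, R f = V (f - S f + (m : ℂ) • R f)) (hS : ∀ f, B (S f) = R f)
    {y n a : X} (hn : y = V n) (ha : y = B a) : R (n - (m : ℂ) • y + a) = y := by
  set f := n - (m : ℂ) • y + a with hf
  have h1 : B (a - S f) = y - R f := by rw [map_sub, hS, ← ha]
  have h2 : y - R f = V ((m : ℂ) • (y - R f) - (a - S f)) := by
    conv_lhs => rw [hR f]; enter [1]; rw [hn]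
    rw [← map_sub]
    congr 1
    rw [hf]
    simp only [smul_sub]
    abel
  have h3 : a - S f = 0 := by
    refine h.eq_zero_of_add_eq_zero hm hV hQV ?_
    rw [hBV, h1]
    conv_lhs => enter [1]; rw [h2]
    rw [map_sub, map_smul]
    abel
  rw [h3, map_zero] at h1
  exact (sub_eq_zero.mp h1.symm).symm

end IsPosInverse

variable [CompleteSpace X]

theorem exists_symm_sqrt (T : X →L[ℂ] X) (hs : ∀ x y, inner ℂ (T x) y = inner ℂ x (T y))
    (hp : ∀ x, 0 ≤ (inner ℂ (T x) x).re) :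
    ∃ J : X →L[ℂ] X, (∀ x y, inner ℂ (J x) y = inner ℂ x (J y)) ∧ ∀ x, J (J x) = T x := by
  have h0 : 0 ≤ T := by
    rw [ContinuousLinearMap.nonneg_iff_isPositive]
    exact ⟨hs, hp⟩
  refine ⟨CFC.sqrt T, fun x y => ?_, fun x => ?_⟩
  · exact ((ContinuousLinearMap.nonneg_iff_isPositive _).mp (CFC.sqrt_nonneg T)).isSymmetric x y
  · exact DFunLike.congr_fun (CFC.sqrt_mul_sqrt_self T h0) x

/-- B - m B² ≥ 0 is the lower bound itself, and the bound also gives m ‖B x‖ ≤ ‖x‖, hence 1 - m B ≥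
0. The roots can thus be taken in H, before lifting to functions of t, so that they commute with
every operator acting in t alone. -/
theorem exists_isPosInverse (B : X →L[ℂ] X) {m : ℝ} (hm : 0 < m)
    (hs : ∀ x y, inner ℂ (B x) y = inner ℂ x (B y)) (hi : ∀ x, B x = 0 → x = 0)
    (hB : ∀ x, m * ‖B x‖ ^ 2 ≤ (inner ℂ (B x) x).re) :
    ∃ J Q : X →L[ℂ] X, IsPosInverse B J Q m := by
  have hmn : ∀ x, m * ‖B x‖ ≤ ‖x‖ := fun x => by
    have h1 := (hB x).trans ((Complex.re_le_norm _).trans (norm_inner_le_norm _ _))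
    rcases (norm_nonneg (B x)).eq_or_lt with h | h
    · rw [← h]; simp
    · rw [pow_two, ← mul_assoc, mul_comm] at h1
      exact le_of_mul_le_mul_left h1 h
  obtain ⟨J, hJ1, hJ2⟩ := exists_symm_sqrt (B - (m : ℂ) • (B ∘L B))
    (fun x y => by
      simp only [sub_apply, smul_apply,
        ContinuousLinearMap.comp_apply, inner_sub_left, inner_sub_right, inner_smul_left,
        inner_smul_right, hs, Complex.conj_ofReal])
    (fun x => by
      simp only [sub_apply, smul_apply,
        ContinuousLinearMap.comp_apply, inner_sub_left, inner_smul_left, Complex.conj_ofReal,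
        Complex.sub_re, Complex.re_ofReal_mul]
      rw [hs (B x) x, re_inner_self]
      exact sub_nonneg.mpr (hB x))
  obtain ⟨Q, hQ1, hQ2⟩ := exists_symm_sqrt (1 - (m : ℂ) • B)
    (fun x y => by
      simp only [sub_apply, smul_apply,
        one_apply_eq_self, inner_sub_left, inner_sub_right, inner_smul_left,
        inner_smul_right, hs, Complex.conj_ofReal])
    (fun x => by
      simp only [sub_apply, smul_apply,
        one_apply_eq_self, inner_sub_left, inner_smul_left, Complex.conj_ofReal,
        Complex.sub_re, Complex.re_ofReal_mul]
      have h1 := (Complex.re_le_norm _).trans (norm_inner_le_norm (𝕜 := ℂ) (B x) x)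
      rw [re_inner_self]
      nlinarith [mul_le_mul_of_nonneg_right (hmn x) (norm_nonneg x)])
  exact ⟨J, Q, hs, hi, hJ1, hQ1, fun x => by simpa using hJ2 x, fun x => by simpa using hQ2 x⟩

/-- The resolvent of a sum: with `V = N⁻¹` for an accretive `N` commuting with `B = A⁻¹`, the
equation `N w + (A - m) w = f` is solved by `w = R f`, with `A w = S f`. -/
theorem IsPosInverse.exists_resolvent {B J Q V : X →L[ℂ] X} {m : ℝ} (h : IsPosInverse B J Q m) (hm : 0 < m)
    (hV : ∀ x, 0 ≤ (inner ℂ (V x) x).re) (hBV : ∀ x, B (V x) = V (B x))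
    (hJV : ∀ x, J (V x) = V (J x)) (hQV : ∀ x, Q (V x) = V (Q x)) :
    ∃ R S : X →L[ℂ] X, (∀ f, R f = V (f - S f + (m : ℂ) • R f)) ∧ ∀ f, B (S f) = R f := by
  -- For w = V B x one has N w = B x and A w = V x, so N w + (A - m) w = T x: the range of T
  -- consists of right-hand sides with an explicit solution.
  let T : X →L[ℂ] X := B + (V - (m : ℂ) • (B ∘L V))
  have hT : ∀ x, T x = B x + (V x - (m : ℂ) • B (V x)) := fun x => by simp [T]
  let V' := ContinuousLinearMap.adjoint V
  have hV' : ∀ x, 0 ≤ (inner ℂ (V' x) x).re := fun x => by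
    rw [ContinuousLinearMap.adjoint_inner_left, ← inner_conj_symm, Complex.conj_re]
    exact hV x
  have comm' : ∀ C : X →L[ℂ] X, (∀ x y, inner ℂ (C x) y = inner ℂ x (C y)) →
      (∀ x, C (V x) = V (C x)) → ∀ x, C (V' x) = V' (C x) := fun C hC hCV x => by
    refine ext_inner_right ℂ fun y => ?_
    rw [hC, ContinuousLinearMap.adjoint_inner_left, ContinuousLinearMap.adjoint_inner_left, hC, hCV]
  -- The adjoint of T has the same form with the accretive V' in place of V, hence is injective.
  have hdense : DenseRange T := by
    have hbot : (LinearMap.range T.toLinearMap)ᗮ = ⊥ := by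
      refine (Submodule.eq_bot_iff _).mpr fun z hz => ?_
      refine h.eq_zero_of_add_eq_zero hm hV' (comm' Q h.symmQ hQV) (ext_inner_right ℂ fun x => ?_)
      have h1 := Submodule.inner_left_of_mem_orthogonal (𝕜 := ℂ) (LinearMap.mem_range_self T.toLinearMap x) hz
      change inner ℂ z (T x) = 0 at h1
      rw [inner_zero_left, ← h1, hT, hBV]
      simp only [inner_add_left, inner_add_right, inner_sub_left, inner_sub_right, inner_smul_left,
        inner_smul_right, h.symm, Complex.conj_ofReal]
      rw [ContinuousLinearMap.adjoint_inner_left, ContinuousLinearMap.adjoint_inner_left]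
    have := (Submodule.topologicalClosure_eq_top_iff (K := LinearMap.range T.toLinearMap)).mpr hbot
    have hd := (Submodule.dense_iff_topologicalClosure_eq_top).mpr this
    exact hd
  -- The two summands of T x have a cross term with nonnegative real part, because B (1 - m B) = J²
  -- and J commutes with V.
  have hnorm : ∀ x, ‖B x‖ ≤ 1 * ‖T x‖ := fun x => by
    have h1 : 0 ≤ (inner ℂ (B x) (V x - (m : ℂ) • B (V x))).re := by
      have : inner ℂ (B x) (V x - (m : ℂ) • B (V x)) = inner ℂ (J x) (V (J x)) := by
        rw [← hJV, ← h.symmJ, h.sqJ]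
        simp only [inner_sub_left, inner_sub_right, inner_smul_left, inner_smul_right,
          Complex.conj_ofReal, ← h.symm]
      rw [this, ← inner_conj_symm, Complex.conj_re]
      exact hV _
    have h2 := norm_add_sq (𝕜 := ℂ) (B x) (V x - (m : ℂ) • B (V x))
    rw [← hT] at h2
    change _ = _ + 2 * (inner ℂ (B x) (V x - (m : ℂ) • B (V x))).re + _ at h2
    rw [one_mul]
    refine (sq_le_sq₀ (norm_nonneg _) (norm_nonneg _)).mp ?_
    nlinarith [sq_nonneg ‖V x - (m : ℂ) • B (V x)‖]
  -- Y is f ↦ N w, extended by continuity from the dense range of T; then w = V Y f and A w = f - Y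
  -- f + m w.
  let Y : X →L[ℂ] X := B.toLinearMap.extendOfNorm T.toLinearMap
  have hY : ∀ x, Y (T x) = B x := fun x =>
    LinearMap.extendOfNorm_eq (f := B.toLinearMap) (e := T.toLinearMap) hdense ⟨1, hnorm⟩ x
  refine ⟨V ∘L Y, 1 - Y + (m : ℂ) • (V ∘L Y), fun f => ?_, fun f => ?_⟩
  · simp only [add_apply, sub_apply, one_apply_eq_self, smul_apply, ContinuousLinearMap.comp_apply]
    congr 1
    abel
  · refine hdense.induction_on (p := fun f => B ((1 - Y + (m : ℂ) • (V ∘L Y)) f) = (V ∘L Y) f) f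
      (isClosed_eq (by fun_prop) (by fun_prop)) fun x => ?_
    simp only [add_apply, sub_apply,
      one_apply_eq_self, smul_apply,
      ContinuousLinearMap.comp_apply, hY]
    rw [hT, ← hBV]
    congr 1
    abel

end Abstract

/-! ### The inverse of the operator `A` -/

variable {H : Type*} [NormedAddCommGroup H] [InnerProductSpace ℂ H] [CompleteSpace H]

/-- Since m ‖x‖ ≤ ‖A x‖, the projection of the closed graph to its second component is bounded
below, so the range of A is closed. Its orthogonal complement is the kernel of A* = A, which is
trivial by the same bound. -/
theorem exists_inverse (A : H →ₗ.[ℂ] H) (hA : IsSelfAdjoint A) {m : ℝ} (hm : 0 < m)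
    (hA_ge : ∀ x : A.domain, m * ‖(x : H)‖ ^ 2 ≤ (inner ℂ (A x) (x : H)).re) :
    ∃ B : H →L[ℂ] H, (∀ x y, (x, y) ∈ A.graph ↔ x = B y) ∧
      (∀ x y, inner ℂ (B x) y = inner ℂ x (B y)) ∧ (∀ x, B x = 0 → x = 0) ∧
      ∀ x, m * ‖B x‖ ^ 2 ≤ (inner ℂ (B x) x).re := by
  have hge : ∀ x y, (x, y) ∈ A.graph → m * ‖x‖ ^ 2 ≤ (inner ℂ y x).re := fun x y hxy => by
    obtain ⟨z, rfl, rfl⟩ := (LinearPMap.mem_graph_iff A).mp hxy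
    exact hA_ge z
  have hle : ∀ x y, (x, y) ∈ A.graph → m * ‖x‖ ≤ ‖y‖ := fun x y hxy => by
    have h1 := (hge x y hxy).trans ((Complex.re_le_norm _).trans (norm_inner_le_norm _ _))
    rcases (norm_nonneg x).eq_or_lt with h | h
    · rw [← h]; simp
    · rw [pow_two, ← mul_assoc] at h1
      exact le_of_mul_le_mul_right h1 h
  have hsym : ∀ x y x' y', (x, y) ∈ A.graph → (x', y') ∈ A.graph →
      inner ℂ y x' = inner ℂ x y' := fun x y x' y' h h' => by
    have := LinearPMap.adjoint_isFormalAdjoint hA.dense_domain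
    rw [LinearPMap.isSelfAdjoint_def.mp hA] at this
    obtain ⟨z, rfl, rfl⟩ := (LinearPMap.mem_graph_iff A).mp h
    obtain ⟨z', rfl, rfl⟩ := (LinearPMap.mem_graph_iff A).mp h'
    exact this z z'
  have hcl : IsClosed (A.graph : Set (H × H)) := hA.isClosed
  have : CompleteSpace A.graph := hcl.completeSpace_coe
  let p : A.graph →L[ℂ] H := (ContinuousLinearMap.snd ℂ H H) ∘L A.graph.subtypeL
  have hanti : AntilipschitzWith (Real.toNNReal (max 1 m⁻¹)) p := by
    refine ContinuousLinearMap.antilipschitz_of_bound _ fun z => ?_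
    have h1 := hle z.1.1 z.1.2 z.2
    have h0 : 0 < max 1 m⁻¹ := lt_max_of_lt_left one_pos
    rw [Real.coe_toNNReal _ h0.le]
    change ‖z.1‖ ≤ _ * ‖z.1.2‖
    rw [Prod.norm_def]
    refine max_le ?_ ?_
    · calc ‖z.1.1‖ = m⁻¹ * (m * ‖z.1.1‖) := by field_simp
        _ ≤ m⁻¹ * ‖z.1.2‖ := by gcongr
        _ ≤ _ := by gcongr; exact le_max_right _ _
    · nlinarith [norm_nonneg z.1.2, le_max_left 1 m⁻¹]
  have hinj : Function.Injective p := hanti.injective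
  have hclr : IsClosed (Set.range p) := hanti.isClosed_range p.uniformContinuous
  have hsurj : Function.Surjective p := by
    have hbot : (LinearMap.range p.toLinearMap)ᗮ = ⊥ := by
      refine (Submodule.eq_bot_iff _).mpr fun z hz => ?_
      have h1 : ∀ x : A.domain, inner ℂ z (A x) = 0 := fun x =>
        Submodule.inner_left_of_mem_orthogonal (𝕜 := ℂ)
          (LinearMap.mem_range_self p.toLinearMap ⟨_, A.mem_graph x⟩) hz
      have h2 : (z, (0 : H)) ∈ A.graph := by
        rw [← LinearPMap.isSelfAdjoint_def.mp hA,
          LinearPMap.adjoint_graph_eq_graph_adjoint hA.dense_domain, Submodule.mem_adjoint_iff]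
        intro a b hab
        obtain ⟨x, rfl, rfl⟩ := (LinearPMap.mem_graph_iff A).mp hab
        have h3 := h1 x
        rw [← inner_conj_symm, map_eq_zero] at h3
        simp [h3]
      have h3 := hle z 0 h2
      rw [norm_zero] at h3
      have h4 : ‖z‖ ≤ 0 := by nlinarith
      simpa using h4
    have h1 := (Submodule.topologicalClosure_eq_top_iff (K := LinearMap.range p.toLinearMap)).mpr hbot
    have hd := (Submodule.dense_iff_topologicalClosure_eq_top).mpr h1
    have hcl' : IsClosed ((LinearMap.range p.toLinearMap : Submodule ℂ H) : Set H)
      := hclr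
    intro y
    have := hd y
    rw [hcl'.closure_eq] at this
    exact this
  let e : A.graph ≃ₗ[ℂ] H := LinearEquiv.ofBijective p.toLinearMap ⟨hinj, hsurj⟩
  have he : ∀ y, (e.symm y).1.2 = y := fun y => e.apply_symm_apply y
  have hmem : ∀ y, ((e.symm y).1.1, y) ∈ A.graph := fun y => by
    have := (e.symm y).2
    rwa [show (e.symm y).1 = ((e.symm y).1.1, y) from Prod.ext rfl (he y)] at this
  let B : H →L[ℂ] H := LinearMap.mkContinuous
    ((LinearMap.fst ℂ H H) ∘ₗ A.graph.subtype ∘ₗ e.symm.toLinearMap) m⁻¹ fun y => by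
      have h1 := hle _ _ (hmem y)
      change ‖(e.symm y).1.1‖ ≤ _
      calc ‖(e.symm y).1.1‖ = m⁻¹ * (m * ‖(e.symm y).1.1‖) := by field_simp
        _ ≤ _ := by gcongr
  have hB : ∀ y, (B y, y) ∈ A.graph := hmem
  have hiff : ∀ x y, (x, y) ∈ A.graph ↔ x = B y := fun x y => by
    constructor
    · intro hxy
      have h1 : (⟨(x, y), hxy⟩ : A.graph) = ⟨(B y, y), hB y⟩ := hinj rfl
      exact congrArg (fun z : A.graph => z.1.1) h1
    · rintro rfl
      exact hB y
  refine ⟨B, hiff, fun x y => ?_, fun x hx => ?_, fun x => ?_⟩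
  · exact (hsym _ _ _ _ (hB x) (hB y)).symm
  · have := hB x
    rw [hx] at this
    exact A.graph_fst_eq_zero_snd this rfl
  · have := hge _ _ (hB x)
    rwa [← hsym _ _ _ _ (hB x) (hB x)]

end

section

/-! ### Primitives of locally integrable functions -/

section Primitive

variable {E F G : Type*} [NormedAddCommGroup E]

/-- Integrability on all intervals `(0, T]`. -/
def LocInt (g : ℝ → E) : Prop := ∀ T : ℝ, IntegrableOn g (Ioc 0 T)

theorem LocInt.add {g h : ℝ → E} (hg : LocInt g) (hh : LocInt h) :
    LocInt (fun t => g t + h t) := fun T => (hg T).add (hh T)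

theorem locInt_of_continuous {g : ℝ → E} (hg : Continuous g) : LocInt g := fun _ =>
  hg.integrableOn_Ioc

variable [NormedSpace ℝ E] [NormedAddCommGroup F] [NormedSpace ℝ F]
  [NormedAddCommGroup G] [NormedSpace ℝ G]

/-- The primitive of `g` on the half-line that vanishes at `0`. -/
def prim (g : ℝ → E) (t : ℝ) : E := ∫ s in Ioc 0 t, g s

theorem prim_zero (g : ℝ → E) : prim g 0 = 0 := by simp [prim]

theorem prim_congr_ae {g h : ℝ → E} (hgh : g =ᵐ[volume.restrict (Ioi 0)] h) : prim g = prim h := by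
  funext t
  exact integral_congr_ae (ae_mono (Measure.restrict_mono Ioc_subset_Ioi_self le_rfl) hgh)

theorem prim_add {g h : ℝ → E} (hg : LocInt g) (hh : LocInt h) (t : ℝ) :
    prim (fun t => g t + h t) t = prim g t + prim h t := integral_add (hg t) (hh t)

theorem prim_const_smul (c : ℝ) (g : ℝ → E) (t : ℝ) :
    prim (fun t => c • g t) t = c • prim g t := integral_smul c g

theorem LocInt.continuous_smul {g : ℝ → E} (hg : LocInt g) {φ : ℝ → ℝ} (hφ : Continuous φ) :
    LocInt (fun t => φ t • g t) := fun T => by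
  have h1 := ((integrableOn_Icc_iff_integrableOn_Ioc (by simp)).mpr (hg T)).continuousOn_smul
    hφ.continuousOn isCompact_Icc
  exact h1.mono_set Ioc_subset_Icc_self

theorem prim_eq_intervalIntegral (g : ℝ → E) {t : ℝ} (ht : 0 ≤ t) :
    prim g t = ∫ s in (0 : ℝ)..t, g s := (intervalIntegral.integral_of_le ht).symm

theorem prim_eq_intervalIntegral_indicator (g : ℝ → E) (t : ℝ) :
    prim g t = ∫ s in (0 : ℝ)..t, (Ioi 0).indicator g s := by
  rcases le_total 0 t with ht | ht
  · rw [prim_eq_intervalIntegral g ht]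
    refine intervalIntegral.integral_congr_ae (ae_of_all _ fun s hs => ?_)
    rw [uIoc_of_le ht] at hs
    rw [indicator_of_mem (show s ∈ Ioi 0 from hs.1)]
  · rw [prim, Ioc_eq_empty (not_lt.mpr ht), Measure.restrict_empty, integral_zero_measure,
      intervalIntegral.integral_of_ge ht, eq_comm, neg_eq_zero]
    refine setIntegral_eq_zero_of_forall_eq_zero fun s hs => ?_
    exact indicator_of_notMem (by simpa using hs.2) _

theorem continuous_prim {g : ℝ → E} (hg : LocInt g) : Continuous (prim g) := by
  have h : prim g = fun t => ∫ s in (0 : ℝ)..t, (Ioi 0).indicator g s :=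
    funext (prim_eq_intervalIntegral_indicator g)
  rw [h]
  refine intervalIntegral.continuous_primitive (fun a b => ?_) 0
  rw [intervalIntegrable_iff, integrableOn_indicator_iff measurableSet_Ioi]
  refine (hg (max a b)).mono_set fun s hs => ⟨hs.1, ?_⟩
  exact (mem_Ioc.mp hs.2).2

theorem prim_deriv {φ : ℝ → ℝ} (hφ : ContDiff ℝ 1 φ) {t : ℝ} (ht : 0 ≤ t) :
    prim (deriv φ) t = φ t - φ 0 := by
  rw [prim_eq_intervalIntegral _ ht]
  exact intervalIntegral.integral_deriv_eq_sub (fun x _ => hφ.differentiable (by simp) x)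
    ((hφ.continuous_deriv le_rfl).intervalIntegrable _ _)

variable [CompleteSpace E] [CompleteSpace F] [CompleteSpace G]

theorem prim_clm (L : E →L[ℝ] F) {g : ℝ → E} (hg : LocInt g) (t : ℝ) :
    prim (fun s => L (g s)) t = L (prim g t) := L.integral_comp_comm (hg t)

/-- Integration by parts for a bilinear product of two primitives. -/
theorem prim_bilin (L : E →L[ℝ] F →L[ℝ] G) {f : ℝ → E} {g : ℝ → F} (hf : LocInt f) (hg : LocInt g)
    (T : ℝ) : L (prim f T) (prim g T) =
      ∫ t in Ioc 0 T, (L (f t) (prim g t) + L (prim f t) (g t)) := by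
  set ν := (volume : Measure ℝ).restrict (Ioc 0 T) with hν
  have hf' : Integrable f ν := hf T
  have hg' : Integrable g ν := hg T
  -- Fubini on the square (0, T]², cut along the diagonal: integrating out s ≤ t produces `prim g
  -- t`, integrating out t < s produces `prim f s`.
  have hprod : Integrable (fun z : ℝ × ℝ => L (f z.1) (g z.2)) (ν.prod ν) :=
    hf'.op_fst_snd (op := fun x y => L x y) (by fun_prop) ⟨‖L‖, L.le_opNorm₂⟩ hg'
  have hms : MeasurableSet {z : ℝ × ℝ | z.2 ≤ z.1} := measurableSet_le measurable_snd measurable_fst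
  have hI := hprod.indicator hms
  have hI' := hprod.indicator hms.compl
  have e1 : ∀ t ∈ Ioc 0 T, ∫ s, {z : ℝ × ℝ | z.2 ≤ z.1}.indicator
      (fun z => L (f z.1) (g z.2)) (t, s) ∂ν = L (f t) (prim g t) := fun t ht => by
    rw [prim, ← (L (f t)).integral_comp_comm (hg t), hν, ← integral_indicator measurableSet_Ioc,
      ← integral_indicator measurableSet_Ioc]
    refine integral_congr_ae (ae_of_all _ fun s => ?_)
    have h1 := ht.2
    simp only [indicator, mem_ofPred_eq, mem_Ioc]
    split_ifs <;> first | rfl | (exfalso; grind)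
  have e2 : ∀ s ∈ Ioc 0 T, ∫ t, {z : ℝ × ℝ | z.2 ≤ z.1}ᶜ.indicator
      (fun z => L (f z.1) (g z.2)) (t, s) ∂ν = L (prim f s) (g s) := fun s hs => by
    have h0 : L (prim f s) (g s) = ∫ t in Ioo 0 s, L (f t) (g s) := by
      rw [← integral_Ioc_eq_integral_Ioo]
      exact ((L.flip (g s)).integral_comp_comm (hf s)).symm
    rw [h0, hν, ← integral_indicator measurableSet_Ioo, ← integral_indicator measurableSet_Ioc]
    refine integral_congr_ae (ae_of_all _ fun t => ?_)
    have h1 := hs.2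
    simp only [indicator, mem_compl_iff, mem_ofPred_eq, mem_Ioc, mem_Ioo, not_le]
    split_ifs <;> first | rfl | (exfalso; grind)
  have a1 : Integrable (fun t => L (f t) (prim g t)) ν :=
    hI.integral_prod_left.congr ((ae_restrict_mem measurableSet_Ioc).mono e1)
  have a2 : Integrable (fun t => L (prim f t) (g t)) ν :=
    hI'.integral_prod_right.congr ((ae_restrict_mem measurableSet_Ioc).mono e2)
  rw [integral_add a1 a2]
  have h1 : ∫ t, L (f t) (prim g t) ∂ν = ∫ z, {z : ℝ × ℝ | z.2 ≤ z.1}.indicator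
      (fun z => L (f z.1) (g z.2)) z ∂(ν.prod ν) := by
    rw [integral_prod _ hI]
    exact integral_congr_ae ((ae_restrict_mem measurableSet_Ioc).mono fun t ht => (e1 t ht).symm)
  have h2 : ∫ t, L (prim f t) (g t) ∂ν = ∫ z, {z : ℝ × ℝ | z.2 ≤ z.1}ᶜ.indicator
      (fun z => L (f z.1) (g z.2)) z ∂(ν.prod ν) := by
    rw [integral_prod_symm _ hI']
    exact integral_congr_ae ((ae_restrict_mem measurableSet_Ioc).mono fun t ht => (e2 t ht).symm)
  rw [h1, h2, ← integral_add hI hI']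
  simp_rw [indicator_self_add_compl_apply]
  exact (integral_prod_bilin (𝕜 := ℝ) L hf' hg').symm

/-- Product rule for a smooth factor. Since `prim` only represents functions vanishing at 0, the
bilinear formula is applied to φ - φ 0 and the constant φ 0 is handled by linearity. All
integrating-factor arguments rest on this. -/
theorem smul_prim {φ : ℝ → ℝ} (hφ : ContDiff ℝ 1 φ) {g : ℝ → E} (hg : LocInt g) {t : ℝ}
    (ht : 0 ≤ t) : φ t • prim g t = prim (fun s => deriv φ s • prim g s + φ s • g s) t := by
  have hd : Continuous (deriv φ) := hφ.continuous_deriv le_rfl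
  have h1 := prim_bilin (ContinuousLinearMap.lsmul ℝ ℝ (E := E)) (locInt_of_continuous hd) hg t
  simp only [ContinuousLinearMap.lsmul_apply] at h1
  rw [prim_deriv hφ ht, sub_smul, sub_eq_iff_eq_add] at h1
  have h2 : φ 0 • prim g t = prim (fun s => φ 0 • g s) t := (prim_const_smul _ _ _).symm
  have i1 : LocInt fun s => deriv φ s • prim g s + prim (deriv φ) s • g s :=
    (locInt_of_continuous (hd.smul (continuous_prim hg))).add
      (hg.continuous_smul (continuous_prim (locInt_of_continuous hd)))
  rw [h1, h2]
  change prim _ t + _ = _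
  rw [← prim_add i1 (hg.continuous_smul continuous_const)]
  refine setIntegral_congr_fun measurableSet_Ioc fun s hs => ?_
  simp only [prim_deriv hφ hs.1.le, sub_smul]
  abel

end Primitive

variable {H : Type*} [NormedAddCommGroup H] [InnerProductSpace ℂ H]

/-- The real part of the inner product as a continuous real bilinear map. -/
def reInner (H : Type*) [NormedAddCommGroup H] [InnerProductSpace ℂ H] : H →L[ℝ] H →L[ℝ] ℝ :=
  LinearMap.mkContinuous₂
    (LinearMap.mk₂ ℝ (fun x y : H => (inner ℂ x y).re)
      (fun x y z => by rw [inner_add_left, Complex.add_re])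
      (fun c x y => by
        rw [← Complex.coe_smul, inner_smul_left, Complex.conj_ofReal, Complex.re_ofReal_mul,
          smul_eq_mul])
      (fun x y z => by rw [inner_add_right, Complex.add_re])
      (fun c x y => by
        rw [← Complex.coe_smul, inner_smul_right, Complex.re_ofReal_mul, smul_eq_mul])) 1
    fun x y => by
      rw [one_mul]
      exact (Complex.abs_re_le_norm _).trans (norm_inner_le_norm _ _)

theorem reInner_apply (x y : H) : reInner H x y = (inner ℂ x y).re := rfl

theorem reInner_comm (x y : H) : reInner H x y = reInner H y x := by
  rw [reInner_apply, reInner_apply, ← inner_conj_symm, Complex.conj_re]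

theorem norm_sq_prim [CompleteSpace H] {g : ℝ → H} (hg : LocInt g) (T : ℝ) :
    ‖prim g T‖ ^ 2 = prim (fun t => 2 * reInner H (g t) (prim g t)) T := by
  have h := prim_bilin (reInner H) hg hg T
  rw [reInner_apply, re_inner_self] at h
  rw [h]
  refine integral_congr_ae (ae_of_all _ fun t => ?_)
  simp only
  rw [reInner_comm (prim g t), two_mul]

end

section

/-! ### Elementary facts on `L_{2,κ}(ℝ₊; H)` -/

section Weighted

variable {E : Type*} [NormedAddCommGroup E] [NormedSpace ℝ E]

theorem integral_wMeasure (κ : ℝ) (F : ℝ → E) :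
    ∫ t, F t ∂wMeasure κ = ∫ t in Ioi 0, Real.exp (-κ * t) • F t := by
  rw [wMeasure, integral_withDensity_eq_integral_toReal_smul (by fun_prop) (by simp)]
  simp only [ENNReal.toReal_ofReal (Real.exp_pos _).le]

theorem integrable_wMeasure_iff (κ : ℝ) (F : ℝ → E) :
    Integrable F (wMeasure κ) ↔
      Integrable (fun t => Real.exp (-κ * t) • F t) (volume.restrict (Ioi 0)) := by
  rw [wMeasure, integrable_withDensity_iff_integrable_smul' (by fun_prop) (by simp)]
  simp only [ENNReal.toReal_ofReal (Real.exp_pos _).le]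

end Weighted

variable {H : Type*} [NormedAddCommGroup H] {κ : ℝ}

theorem ae_coeFn_add (u v : L2w κ H) :
    ∀ᵐ t ∂volume.restrict (Ioi (0 : ℝ)), (u + v) t = u t + v t :=
  (ae_wMeasure_iff κ).mp (Lp.coeFn_add u v)

theorem ae_coeFn_sub (u v : L2w κ H) :
    ∀ᵐ t ∂volume.restrict (Ioi (0 : ℝ)), (u - v) t = u t - v t :=
  (ae_wMeasure_iff κ).mp (Lp.coeFn_sub u v)

theorem L2w_ext {u v : L2w κ H} (h : ∀ᵐ t ∂volume.restrict (Ioi (0 : ℝ)), u t = v t) : u = v :=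
  Lp.ext ((ae_wMeasure_iff κ).mpr h)

theorem integrable_norm_sq_L2w (u : L2w κ H) :
    IntegrableOn (fun t => Real.exp (-κ * t) * ‖u t‖ ^ 2) (Ioi 0) :=
  (integrable_wMeasure_iff κ _).mp ((memLp_two_iff_integrable_sq_norm (Lp.memLp u).1).mp (Lp.memLp u))

variable [InnerProductSpace ℂ H]

theorem ae_coeFn_smul (c : ℂ) (v : L2w κ H) :
    ∀ᵐ t ∂volume.restrict (Ioi (0 : ℝ)), (c • v) t = c • v t :=
  (ae_wMeasure_iff κ).mp (Lp.coeFn_smul c v)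

theorem locInt_L2w (u : L2w κ H) : LocInt u := fun T => by
  obtain ⟨ψ, hψ1, -, hψc, -⟩ := exists_continuous_one_zero_of_isCompact
    (X := ℝ) (isCompact_Icc (a := 0) (b := T)) isClosed_empty (disjoint_empty _)
  have hi := integrable_smul_L2w ψ.continuous hψc u
  have hi' : IntegrableOn (fun t => ψ t • u t) (Ioc 0 T) volume :=
    IntegrableOn.mono_set hi Ioc_subset_Ioi_self
  exact hi'.congr_fun (fun t ht => by simp [hψ1 (Ioc_subset_Icc_self ht)]) measurableSet_Ioc

theorem norm_sq_L2w (u : L2w κ H) : ‖u‖ ^ 2 = ∫ t in Ioi 0, Real.exp (-κ * t) * ‖u t‖ ^ 2 := by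
  rw [← re_inner_self, L2.inner_def, integral_wMeasure]
  simp only [inner_self_eq_norm_sq_to_K (𝕜 := ℂ)]
  rw [← Complex.ofReal_re (∫ t in Ioi 0, Real.exp (-κ * t) * ‖u t‖ ^ 2), ← integral_complex_ofReal]
  congr 1
  refine integral_congr_ae (ae_of_all _ fun t => ?_)
  simp

theorem re_inner_L2w (u v : L2w κ H) : (inner ℂ u v).re =
    ∫ t in Ioi 0, Real.exp (-κ * t) * reInner H (u t) (v t) := by
  have h := (integrable_wMeasure_iff κ _).mp (L2.integrable_inner (𝕜 := ℂ) u v)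
  rw [L2.inner_def, integral_wMeasure, ← RCLike.re_eq_complex_re, ← integral_re h]
  refine integral_congr_ae (ae_of_all _ fun t => ?_)
  simp only [RCLike.re_eq_complex_re, Complex.real_smul, Complex.re_ofReal_mul, reInner_apply]

theorem integrable_reInner_L2w (u v : L2w κ H) :
    IntegrableOn (fun t => Real.exp (-κ * t) * reInner H (u t) (v t)) (Ioi 0) := by
  have h := ((integrable_wMeasure_iff κ _).mp (L2.integrable_inner (𝕜 := ℂ) u v)).re
  refine h.congr (ae_of_all _ fun t => ?_)
  simp only [RCLike.re_eq_complex_re, Complex.real_smul, Complex.re_ofReal_mul, reInner_apply]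

/-! ### Bounded operators acting pointwise -/

/-- The operator `u ↦ T u(·)` in `L_{2,κ}` for a bounded `T`. -/
def lift (κ : ℝ) (T : H →L[ℂ] H) : L2w κ H →L[ℂ] L2w κ H := T.compLpL 2 (wMeasure κ)

theorem lift_ae (T : H →L[ℂ] H) (u : L2w κ H) :
    ∀ᵐ t ∂volume.restrict (Ioi (0 : ℝ)), lift κ T u t = T (u t) :=
  (ae_wMeasure_iff κ).mp (T.coeFn_compLpL u)

theorem lift_symm {T : H →L[ℂ] H} (hT : ∀ x y, inner ℂ (T x) y = inner ℂ x (T y)) (u v : L2w κ H) :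
    inner ℂ (lift κ T u) v = inner ℂ u (lift κ T v) := by
  rw [L2.inner_def, L2.inner_def]
  refine integral_congr_ae ?_
  filter_upwards [T.coeFn_compLpL (p := 2) (μ := wMeasure κ) u,
    T.coeFn_compLpL (p := 2) (μ := wMeasure κ) v] with t h1 h2
  rw [lift, h1, h2, hT]

theorem IsPosInverse.lift {B J Q : H →L[ℂ] H} {m : ℝ} (h : IsPosInverse B J Q m) (κ : ℝ) :
    IsPosInverse (lift κ B) (lift κ J) (lift κ Q) m where
  symm := lift_symm h.symm
  symmJ := lift_symm h.symmJ
  symmQ := lift_symm h.symmQ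
  inj u hu := by
    refine (Lp.eq_zero_iff_ae_eq_zero).mpr ((ae_wMeasure_iff κ).mpr ?_)
    have h0 := (ae_wMeasure_iff κ).mp (Lp.coeFn_zero H 2 (wMeasure κ))
    rw [← hu] at h0
    filter_upwards [h0, lift_ae B u] with t h1 h2
    exact h.inj _ (h2.symm.trans h1)
  sqJ u := by
    refine L2w_ext ?_
    filter_upwards [lift_ae J (WeightedODE.lift κ J u), lift_ae J u, lift_ae B u,
      lift_ae B (WeightedODE.lift κ B u),
      ae_coeFn_sub (WeightedODE.lift κ B u) ((m : ℂ) • WeightedODE.lift κ B (WeightedODE.lift κ B u)),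
      ae_coeFn_smul (m : ℂ) (WeightedODE.lift κ B (WeightedODE.lift κ B u))] with t h1 h2 h3 h4 h5 h6
    rw [h1, h2, h5, h6, h4, h3, h.sqJ]
  sqQ u := by
    refine L2w_ext ?_
    filter_upwards [lift_ae Q (WeightedODE.lift κ Q u), lift_ae Q u, lift_ae B u,
      ae_coeFn_sub u ((m : ℂ) • WeightedODE.lift κ B u),
      ae_coeFn_smul (m : ℂ) (WeightedODE.lift κ B u)] with t h1 h2 h3 h4 h5
    rw [h1, h2, h4, h5, h3, h.sqQ]

/-! ### The Volterra operator `(d/dt + ν)⁻¹` with zero initial value -/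

/-- `y` is the primitive of `g` that vanishes at `0`. -/
def HasPrim (y g : L2w κ H) : Prop := ∀ᵐ t ∂volume.restrict (Ioi (0 : ℝ)), y t = prim g t

/-- The solution of `y' + ν y = f`, `y(0) = 0`. -/
def volterraFun (ν : ℝ) (f : ℝ → H) (t : ℝ) : H :=
  Real.exp (-ν * t) • prim (fun s => Real.exp (ν * s) • f s) t

theorem LocInt.exp_smul {f : ℝ → H} (hf : LocInt f) (ν : ℝ) :
    LocInt fun s => Real.exp (ν * s) • f s := hf.continuous_smul (by fun_prop)

theorem continuous_volterraFun (ν : ℝ) {f : ℝ → H} (hf : LocInt f) :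
    Continuous (volterraFun ν f) := by
  have h := continuous_prim (hf.exp_smul ν)
  exact (show Continuous fun t : ℝ => Real.exp (-ν * t) by fun_prop).smul h

theorem exp_deriv (ν : ℝ) : (deriv fun t : ℝ => Real.exp (ν * t)) = fun t => ν * Real.exp (ν * t) := by
  funext t
  have h : HasDerivAt (fun t : ℝ => Real.exp (ν * t)) (Real.exp (ν * t) * (ν * 1)) t :=
    ((hasDerivAt_id t).const_mul ν).exp
  rw [h.deriv]
  ring

theorem LocInt.reInner {f y : ℝ → H} (hf : LocInt f) (hy : Continuous y) :
    LocInt fun t => reInner H (f t) (y t) := fun T => by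
  have h1 : IntegrableOn f (Icc 0 T) :=
    (integrableOn_Icc_iff_integrableOn_Ioc (by simp)).mpr (hf T)
  obtain ⟨C, hC⟩ := isCompact_Icc.exists_bound_of_continuousOn (s := Icc 0 T) hy.continuousOn
  refine IntegrableOn.mono_set (t := Icc 0 T) ?_ Ioc_subset_Icc_self
  refine Integrable.mono' (g := fun t => ‖f t‖ * C) (h1.norm.mul_const C) ?_ ?_
  · exact (WeightedODE.reInner H).aestronglyMeasurable_comp₂ h1.1 hy.aestronglyMeasurable
  · filter_upwards [ae_restrict_mem measurableSet_Icc] with t ht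
    calc ‖WeightedODE.reInner H (f t) (y t)‖ ≤ ‖f t‖ * ‖y t‖ :=
          (Complex.abs_re_le_norm _).trans (norm_inner_le_norm _ _)
      _ ≤ _ := by gcongr; exact hC t ht

theorem volterraFun_congr {ν : ℝ} {f g : ℝ → H} (h : f =ᵐ[volume.restrict (Ioi 0)] g) :
    volterraFun ν f = volterraFun ν g := by
  have h1 : (fun s => Real.exp (ν * s) • f s) =ᵐ[volume.restrict (Ioi 0)]
      fun s => Real.exp (ν * s) • g s := by
    filter_upwards [h] with s hs
    rw [hs]
  funext t
  rw [volterraFun, volterraFun, prim_congr_ae h1]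

theorem volterraFun_add (ν : ℝ) {f g : ℝ → H} (hf : LocInt f) (hg : LocInt g) (t : ℝ) :
    volterraFun ν (fun s => f s + g s) t = volterraFun ν f t + volterraFun ν g t := by
  simp only [volterraFun, smul_add]
  rw [prim_add (hf.exp_smul ν) (hg.exp_smul ν), smul_add]

section Complete

variable [CompleteSpace H]

/-- For y' + ν y = f the integrand is the derivative of e^{-κt} ‖y‖², so the integral is e^{-κT}
‖y(T)‖² ≥ 0. In terms of F = e^{νt} y this is e^{-(2ν+κ)T} ‖F(T)‖². -/
theorem energy_volterraFun {ν : ℝ} {f : ℝ → H} (hf : LocInt f) {T : ℝ} (hT : 0 ≤ T) :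
    0 ≤ prim (fun t => -(2 * ν + κ) * (Real.exp (-κ * t) * ‖volterraFun ν f t‖ ^ 2) +
      2 * (Real.exp (-κ * t) * reInner H (f t) (volterraFun ν f t))) T := by
  set F := prim (fun s => Real.exp (ν * s) • f s) with hF
  have hLI := hf.exp_smul ν
  have hFc : Continuous F := continuous_prim hLI
  have hLI2 : LocInt fun t => 2 * reInner H (Real.exp (ν * t) • f t) (F t) :=
    (hLI.reInner hFc).continuous_smul (φ := fun _ => 2) continuous_const
  have hφ : ContDiff ℝ 1 fun t : ℝ => Real.exp (-(2 * ν + κ) * t) := by fun_prop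
  have h := smul_prim hφ hLI2 hT
  have hN : ∀ t, prim (fun t => 2 * reInner H (Real.exp (ν * t) • f t) (F t)) t = ‖F t‖ ^ 2 :=
    fun t => (norm_sq_prim hLI t).symm
  simp only [hN, exp_deriv] at h
  have h0 : 0 ≤ Real.exp (-(2 * ν + κ) * T) • ‖F T‖ ^ 2 := by
    rw [smul_eq_mul]; positivity
  rw [h] at h0
  refine h0.trans_eq ?_
  refine congrArg (fun g => prim g T) (funext fun t => ?_)
  have e1 : volterraFun ν f t = Real.exp (-ν * t) • F t := rfl
  have e2 : Real.exp (-(2 * ν + κ) * t) =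
      Real.exp (-κ * t) * (Real.exp (-ν * t) * Real.exp (-ν * t)) := by
    rw [← Real.exp_add, ← Real.exp_add]; congr 1; ring
  have e3 : Real.exp (-ν * t) * Real.exp (ν * t) = 1 := by
    rw [← Real.exp_add]; simp
  rw [e1, norm_smul, Real.norm_of_nonneg (Real.exp_pos _).le, map_smul, map_smul,
    smul_apply, e2]
  simp only [smul_eq_mul]
  linear_combination (2 * Real.exp (-κ * t) * Real.exp (-ν * t) * reInner H (f t) (F t)) * e3

/-- With c = 2ν + κ, Young's inequality with weights c/2 and 2/c absorbs half of the dissipative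
term of the energy identity. The bound is uniform in T, which also gives membership in L_{2,κ}. -/
theorem volterraFun_bound {ν : ℝ} (hν : 0 < 2 * ν + κ) (f : L2w κ H) :
    MemLp (volterraFun ν f) 2 (wMeasure κ) ∧
      ∀ T, 0 ≤ T → ∫ t in Ioc 0 T, Real.exp (-κ * t) * ‖volterraFun ν f t‖ ^ 2 ≤
        (2 / (2 * ν + κ)) ^ 2 * ‖f‖ ^ 2 := by
  set c := 2 * ν + κ with hc
  have hcont := continuous_volterraFun ν (locInt_L2w f)
  have hg : Continuous fun t => Real.exp (-κ * t) * ‖volterraFun ν f t‖ ^ 2 := by fun_prop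
  have hb : ∀ T, 0 ≤ T → ∫ t in Ioc 0 T, Real.exp (-κ * t) * ‖volterraFun ν f t‖ ^ 2 ≤
      (2 / c) ^ 2 * ‖f‖ ^ 2 := fun T hT => by
    have h1 := energy_volterraFun (κ := κ) (ν := ν) (locInt_L2w f) hT
    have i1 : IntegrableOn (fun t => Real.exp (-κ * t) * ‖volterraFun ν f t‖ ^ 2) (Ioc 0 T) :=
      hg.integrableOn_Ioc
    have i2 : IntegrableOn (fun t => Real.exp (-κ * t) * ‖f t‖ ^ 2) (Ioc 0 T) :=
      (integrable_norm_sq_L2w f).mono_set Ioc_subset_Ioi_self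
    have h2 : prim (fun t => -c * (Real.exp (-κ * t) * ‖volterraFun ν f t‖ ^ 2) +
        2 * (Real.exp (-κ * t) * reInner H (f t) (volterraFun ν f t))) T ≤
        ∫ t in Ioc 0 T, (-(c / 2) * (Real.exp (-κ * t) * ‖volterraFun ν f t‖ ^ 2) +
          (2 / c) * (Real.exp (-κ * t) * ‖f t‖ ^ 2)) := by
      have i3 : IntegrableOn (fun t => Real.exp (-κ * t) * reInner H (f t) (volterraFun ν f t))
          (Ioc 0 T) :=
        (((locInt_L2w f).reInner hcont).continuous_smul
          (φ := fun t => Real.exp (-κ * t)) (by fun_prop)) T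
      refine integral_mono ((i1.const_mul _).add (i3.const_mul _))
        ((i1.const_mul _).add (i2.const_mul _)) fun t => ?_
      have e1 : reInner H (f t) (volterraFun ν f t) ≤ ‖f t‖ * ‖volterraFun ν f t‖ :=
        (Complex.re_le_norm _).trans (norm_inner_le_norm _ _)
      have e2 : 2 * (‖f t‖ * ‖volterraFun ν f t‖) ≤
          (c / 2) * ‖volterraFun ν f t‖ ^ 2 + (2 / c) * ‖f t‖ ^ 2 := by
        have := sq_nonneg (c / 2 * ‖volterraFun ν f t‖ - ‖f t‖)
        have h0 : 0 ≤ 2 / c * (c / 2 * ‖volterraFun ν f t‖ - ‖f t‖) ^ 2 := by positivity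
        have h1 : 2 / c * (c / 2 * ‖volterraFun ν f t‖ - ‖f t‖) ^ 2 =
            (c / 2) * ‖volterraFun ν f t‖ ^ 2 + (2 / c) * ‖f t‖ ^ 2
              - 2 * (‖f t‖ * ‖volterraFun ν f t‖) := by
          field_simp
          ring
        linarith
      have e3 := mul_le_mul_of_nonneg_left
        ((mul_le_mul_of_nonneg_left e1 zero_le_two).trans e2) (Real.exp_pos (-κ * t)).le
      simp only
      linarith
    rw [integral_add (i1.const_mul _) (i2.const_mul _), integral_const_mul,
      integral_const_mul] at h2
    have h3 : ∫ t in Ioc 0 T, Real.exp (-κ * t) * ‖f t‖ ^ 2 ≤ ‖f‖ ^ 2 := by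
      rw [norm_sq_L2w]
      exact setIntegral_mono_set (integrable_norm_sq_L2w f)
        (ae_of_all _ fun t => by positivity) Ioc_subset_Ioi_self.eventuallyLE
    have h4 := h1.trans h2
    have h5 : c / 2 * ∫ t in Ioc 0 T, Real.exp (-κ * t) * ‖volterraFun ν f t‖ ^ 2 ≤
        2 / c * ‖f‖ ^ 2 := by
      have : 2 / c * ∫ t in Ioc 0 T, Real.exp (-κ * t) * ‖f t‖ ^ 2 ≤ 2 / c * ‖f‖ ^ 2 := by gcongr
      linarith
    calc _ = 2 / c * (c / 2 * ∫ t in Ioc 0 T, Real.exp (-κ * t) * ‖volterraFun ν f t‖ ^ 2) := by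
          field_simp
      _ ≤ 2 / c * (2 / c * ‖f‖ ^ 2) := by gcongr
      _ = _ := by ring
  refine ⟨?_, hb⟩
  rw [memLp_two_iff_integrable_sq_norm hcont.aestronglyMeasurable, integrable_wMeasure_iff]
  refine integrableOn_Ioi_of_intervalIntegral_norm_bounded ((2 / c) ^ 2 * ‖f‖ ^ 2) 0
    (fun T => hg.integrableOn_Ioc) tendsto_id ?_
  filter_upwards [eventually_ge_atTop 0] with T hT
  rw [id, intervalIntegral.integral_of_le hT]
  refine le_trans (le_of_eq ?_) (hb T hT)
  refine integral_congr_ae (ae_of_all _ fun t => ?_)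
  exact Real.norm_of_nonneg (by positivity)

theorem volterraFun_clm (ν : ℝ) {f : ℝ → H} (hf : LocInt f) (L : H →L[ℂ] H) (t : ℝ) :
    volterraFun ν (fun s => L (f s)) t = L (volterraFun ν f t) := by
  have hL : ∀ (c : ℝ) (x : H), L (c • x) = c • L x := fun c x => by
    rw [← Complex.coe_smul, map_smul, Complex.coe_smul]
  have h := prim_clm (L.restrictScalars ℝ) (hf.exp_smul ν) t
  simp only [ContinuousLinearMap.coe_restrictScalars', hL] at h
  rw [volterraFun, volterraFun, h, hL]

/-- The operator `(d/dt + ν)⁻¹` in `L_{2,κ}` with zero initial value. -/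
def volterra (ν : ℝ) (hν : 0 < 2 * ν + κ) : L2w κ H →L[ℂ] L2w κ H :=
  LinearMap.mkContinuous
    { toFun := fun f => (volterraFun_bound hν f).1.toLp
      map_add' := fun f g => by
        rw [← MemLp.toLp_add]
        refine MemLp.toLp_congr _ _ (ae_of_all _ fun t => ?_)
        rw [volterraFun_congr (ae_coeFn_add f g),
          volterraFun_add ν (locInt_L2w f) (locInt_L2w g), Pi.add_apply]
      map_smul' := fun c f => by
        rw [RingHom.id_apply, ← MemLp.toLp_const_smul]
        refine MemLp.toLp_congr _ _ (ae_of_all _ fun t => ?_)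
        rw [volterraFun_congr (ae_coeFn_smul c f)]
        exact volterraFun_clm ν (locInt_L2w f) (c • ContinuousLinearMap.id ℂ H) t }
    (2 / (2 * ν + κ)) fun f => by
      refine (sq_le_sq₀ (norm_nonneg _) (by positivity)).mp ?_
      set y : L2w κ H := (volterraFun_bound hν f).1.toLp with hy
      have hae : ∀ᵐ t ∂volume.restrict (Ioi (0 : ℝ)), y t = volterraFun ν f t :=
        (ae_wMeasure_iff κ).mp (MemLp.coeFn_toLp _)
      change ‖y‖ ^ 2 ≤ _
      rw [norm_sq_L2w, mul_pow]
      refine le_of_tendsto (intervalIntegral_tendsto_integral_Ioi 0 (integrable_norm_sq_L2w y)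
        tendsto_id) ?_
      filter_upwards [eventually_ge_atTop 0] with T hT
      rw [id, intervalIntegral.integral_of_le hT]
      refine le_trans (le_of_eq ?_) ((volterraFun_bound hν f).2 T hT)
      refine integral_congr_ae ?_
      filter_upwards [ae_mono (Measure.restrict_mono Ioc_subset_Ioi_self le_rfl) hae] with t ht
      rw [ht]

variable {ν : ℝ} (hν : 0 < 2 * ν + κ)

theorem volterra_ae (f : L2w κ H) :
    ∀ᵐ t ∂volume.restrict (Ioi (0 : ℝ)), volterra ν hν f t = volterraFun ν f t :=
  (ae_wMeasure_iff κ).mp (MemLp.coeFn_toLp (volterraFun_bound hν f).1)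

/-- On each (0, T] the energy inequality bounds twice the pairing below by (2ν + κ) ∫ e^{-κt} ‖y‖² ≥
0; then T → ∞. -/
theorem re_inner_volterra_nonneg (f : L2w κ H) : 0 ≤ (inner ℂ (volterra ν hν f) f).re := by
  rw [re_inner_L2w]
  refine ge_of_tendsto (intervalIntegral_tendsto_integral_Ioi 0 (integrable_reInner_L2w _ f)
    tendsto_id) ?_
  filter_upwards [eventually_ge_atTop 0] with T hT
  rw [id, intervalIntegral.integral_of_le hT]
  have hcont := continuous_volterraFun ν (locInt_L2w f)
  have i1 : IntegrableOn (fun t => Real.exp (-κ * t) * ‖volterraFun ν f t‖ ^ 2) (Ioc 0 T) :=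
    Continuous.integrableOn_Ioc (by fun_prop)
  have i3 : IntegrableOn (fun t => Real.exp (-κ * t) * reInner H (f t) (volterraFun ν f t))
      (Ioc 0 T) :=
    (((locInt_L2w f).reInner hcont).continuous_smul
      (φ := fun t => Real.exp (-κ * t)) (by fun_prop)) T
  have h := energy_volterraFun (κ := κ) (ν := ν) (locInt_L2w f) hT
  rw [prim, integral_add (i1.const_mul _) (i3.const_mul _), integral_const_mul,
    integral_const_mul] at h
  have h0 : 0 ≤ ∫ t in Ioc 0 T, Real.exp (-κ * t) * ‖volterraFun ν f t‖ ^ 2 :=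
    integral_nonneg fun t => by positivity
  have h1 : 0 ≤ ∫ t in Ioc 0 T, Real.exp (-κ * t) * reInner H (f t) (volterraFun ν f t) := by
    nlinarith [mul_nonneg hν.le h0]
  refine h1.trans_eq (integral_congr_ae ?_)
  filter_upwards [ae_mono (Measure.restrict_mono Ioc_subset_Ioi_self le_rfl) (volterra_ae hν f)]
    with t ht
  rw [ht, reInner_comm]

theorem lift_volterra (T : H →L[ℂ] H) (f : L2w κ H) :
    lift κ T (volterra ν hν f) = volterra ν hν (lift κ T f) := by
  refine L2w_ext ?_
  filter_upwards [lift_ae T (volterra ν hν f), volterra_ae hν f, volterra_ae hν (lift κ T f)]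
    with t h1 h2 h3
  rw [h1, h2, h3, volterraFun_congr (lift_ae T f), volterraFun_clm ν (locInt_L2w f)]

/-- `HasPrim` records the derivative and the zero initial value together; in this sense `volterra`
is a two-sided inverse of d/dt + ν, this being one half and `volterra_of_hasPrim` the other. -/
theorem hasPrim_volterra (f : L2w κ H) :
    HasPrim (volterra ν hν f) (f - (ν : ℂ) • volterra ν hν f) := by
  have hφ : ContDiff ℝ 1 fun t : ℝ => Real.exp (-ν * t) := by fun_prop
  have hae : ∀ᵐ s ∂volume.restrict (Ioi (0 : ℝ)), (f - (ν : ℂ) • volterra ν hν f) s =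
      (-ν * Real.exp (-ν * s)) • prim (fun s => Real.exp (ν * s) • f s) s +
        Real.exp (-ν * s) • Real.exp (ν * s) • f s := by
    filter_upwards [volterra_ae hν f, ae_coeFn_sub f ((ν : ℂ) • volterra ν hν f),
      ae_coeFn_smul (ν : ℂ) (volterra ν hν f)] with s h1 h2 h3
    rw [h2, h3, h1, volterraFun, smul_smul (Real.exp _) (Real.exp _), ← Real.exp_add, neg_mul,
      neg_add_cancel, Real.exp_zero, one_smul, Complex.coe_smul, smul_smul, neg_mul, neg_smul]
    abel
  filter_upwards [volterra_ae hν f, ae_restrict_mem measurableSet_Ioi] with t h1 ht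
  have h2 := smul_prim hφ ((locInt_L2w f).exp_smul ν) (le_of_lt ht)
  rw [exp_deriv] at h2
  rw [h1, volterraFun, h2, prim_congr_ae hae]

theorem volterra_of_hasPrim {y g : L2w κ H} (h : HasPrim y g) :
    volterra ν hν (g + (ν : ℂ) • y) = y := by
  have hφ : ContDiff ℝ 1 fun t : ℝ => Real.exp (ν * t) := by fun_prop
  have hae : ∀ᵐ s ∂volume.restrict (Ioi (0 : ℝ)), Real.exp (ν * s) • (g + (ν : ℂ) • y) s =
      (ν * Real.exp (ν * s)) • prim g s + Real.exp (ν * s) • g s := by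
    filter_upwards [h, ae_coeFn_add g ((ν : ℂ) • y), ae_coeFn_smul (ν : ℂ) y] with s h1 h2 h3
    rw [h2, h3, h1, smul_add, Complex.coe_smul, smul_smul, mul_comm ν (Real.exp _), add_comm]
  refine L2w_ext ?_
  filter_upwards [volterra_ae hν (g + (ν : ℂ) • y), h, ae_restrict_mem measurableSet_Ioi]
    with t h1 h2 ht
  have h3 := smul_prim hφ (locInt_L2w g) (le_of_lt ht)
  rw [exp_deriv] at h3
  rw [h1, h2, volterraFun, prim_congr_ae hae, ← h3, smul_smul, ← Real.exp_add, neg_mul,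
    neg_add_cancel, Real.exp_zero, one_smul]

end Complete

end

section

/-! ### Test functions -/

namespace IsTest

variable {φ ψ : ℝ → ℝ}

theorem deriv (h : IsTest φ) : IsTest (deriv φ) :=
  ⟨(contDiff_infty_iff_deriv.mp h.1).2, h.2.1.deriv, tsupport_deriv_subset.trans h.2.2⟩

theorem iteratedDeriv (h : IsTest φ) (n : ℕ) : IsTest (iteratedDeriv n φ) := by
  induction n with
  | zero => simpa using h
  | succ n ih => rw [iteratedDeriv_succ]; exact ih.deriv

theorem mul_left (h : IsTest φ) {e : ℝ → ℝ} (he : ContDiff ℝ ∞ e) :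
    IsTest fun t => e t * φ t :=
  ⟨he.mul h.1, h.2.1.mul_left, (tsupport_mul_subset_right).trans h.2.2⟩

theorem add (h : IsTest φ) (h' : IsTest ψ) : IsTest fun t => φ t + ψ t :=
  ⟨h.1.add h'.1, h.2.1.add h'.2.1, (tsupport_add φ ψ).trans (union_subset h.2.2 h'.2.2)⟩

theorem eq_zero_of_nonpos (h : IsTest φ) {t : ℝ} (ht : t ≤ 0) : φ t = 0 :=
  image_eq_zero_of_notMem_tsupport fun h' => not_lt.mpr ht (h.2.2 h')

theorem exists_bounds (h : IsTest φ) :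
    ∃ a b : ℝ, 0 < a ∧ a ≤ b ∧ ∀ t, t ∉ Icc a b → φ t = 0 := by
  rcases (tsupport φ).eq_empty_or_nonempty with he | hne
  · exact ⟨1, 1, one_pos, le_rfl, fun t _ =>
      image_eq_zero_of_notMem_tsupport (by rw [he]; exact notMem_empty t)⟩
  · have hc : IsCompact (tsupport φ) := h.2.1
    refine ⟨sInf (tsupport φ), sSup (tsupport φ), h.2.2 (hc.sInf_mem hne),
      csInf_le_csSup hne hc.bddBelow hc.bddAbove, fun t ht => ?_⟩
    refine image_eq_zero_of_notMem_tsupport fun h' => ht ?_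
    exact ⟨csInf_le hc.bddBelow h', le_csSup hc.bddAbove h'⟩

theorem of_bounds (h : ContDiff ℝ ∞ φ) {a b : ℝ} (ha : 0 < a)
    (h0 : ∀ t, t ∉ Icc a b → φ t = 0) : IsTest φ := by
  have hs : tsupport φ ⊆ Icc a b :=
    closure_minimal (fun t ht => by_contra fun h' => ht (h0 t h')) isClosed_Icc
  exact ⟨h, HasCompactSupport.intro isCompact_Icc h0, fun t ht => ha.trans_le (hs ht).1⟩

/-- The difference of a test function and its translate is the derivative of a test function. -/
theorem exists_deriv_eq_sub_translate (h : IsTest φ) {T : ℝ} (hT : 0 ≤ T) :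
    ∃ θ, IsTest θ ∧ _root_.deriv θ = fun t => φ t - φ (t - T) := by
  obtain ⟨a, b, ha, hab, h0⟩ := h.exists_bounds
  have hφc := h.1.continuous
  set g : ℝ → ℝ := fun t => φ t - φ (t - T) with hg
  have hgc : Continuous g := by fun_prop
  have hgs : ContDiff ℝ ∞ g := h.1.sub (h.1.comp (by fun_prop))
  have hd : ∀ t, HasDerivAt (fun t => ∫ s in (0 : ℝ)..t, g s) (g t) t := fun t =>
    intervalIntegral.integral_hasDerivAt_right (hgc.intervalIntegrable _ _)
      (hgc.stronglyMeasurableAtFilter _ _) hgc.continuousAt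
  have hder : _root_.deriv (fun t => ∫ s in (0 : ℝ)..t, g s) = g := funext fun t => (hd t).deriv
  -- This primitive equals the integral of φ over [t - T, t], hence vanishes outside [a, b + T].
  refine ⟨fun t => ∫ s in (0 : ℝ)..t, g s, of_bounds (a := a) (b := b + T) ?_ ha ?_, hder⟩
  · exact contDiff_infty_iff_deriv.mpr ⟨fun t => (hd t).differentiableAt, by rwa [hder]⟩
  · have hz : ∀ t, t ≤ 0 → φ t = 0 := fun t ht => h0 t fun h' => by linarith [h'.1]
    have e0 : ∀ t, ∫ s in (0 : ℝ)..t, φ (s - T) = ∫ s in (0 : ℝ)..(t - T), φ s := fun t => by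
      rw [intervalIntegral.integral_comp_sub_right (fun s => φ s) T, zero_sub,
        ← intervalIntegral.integral_add_adjacent_intervals (a := -T) (b := 0)
          (hφc.intervalIntegrable _ _) (hφc.intervalIntegrable _ _)]
      rw [intervalIntegral.integral_zero_ae, zero_add]
      refine ae_of_all _ fun s hs => hz s ?_
      rw [uIoc_of_le (by linarith)] at hs
      exact hs.2
    have e1 : ∀ t, ∫ s in (0 : ℝ)..t, g s = ∫ s in (t - T)..t, φ s := fun t => by
      rw [hg, intervalIntegral.integral_sub (hφc.intervalIntegrable _ _)
        (Continuous.intervalIntegrable (by fun_prop) _ _), e0,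
        intervalIntegral.integral_interval_sub_left (hφc.intervalIntegrable _ _)
        (hφc.intervalIntegrable _ _)]
    intro t ht
    rw [e1]
    refine intervalIntegral.integral_zero_ae (ae_of_all _ fun s hs => h0 s fun hs' => ht ?_)
    rw [uIoc_of_le (by linarith)] at hs
    exact ⟨hs'.1.trans hs.2, by linarith [hs.1, hs'.2]⟩

end IsTest

/-! ### Weak derivatives -/

variable {H : Type*} [NormedAddCommGroup H] [InnerProductSpace ℂ H] {κ : ℝ}

theorem IsTest.integrable_smul {φ : ℝ → ℝ} (h : IsTest φ) (u : L2w κ H) :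
    Integrable (fun t => φ t • u t) (volume.restrict (Ioi 0)) :=
  integrable_smul_L2w h.1.continuous h.2.1 u

theorem IsTest.integral_smul_sub {φ : ℝ → ℝ} (h : IsTest φ) (u v : L2w κ H) :
    ∫ t in Ioi 0, φ t • (u - v) t = (∫ t in Ioi 0, φ t • u t) - ∫ t in Ioi 0, φ t • v t := by
  rw [← integral_sub (h.integrable_smul u) (h.integrable_smul v)]
  refine integral_congr_ae ?_
  filter_upwards [ae_coeFn_sub u v] with t ht
  rw [ht, smul_sub]

theorem integral_smul_smul (φ : ℝ → ℝ) (c : ℂ) (u : L2w κ H) :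
    ∫ t in Ioi 0, φ t • (c • u) t = c • ∫ t in Ioi 0, φ t • u t := by
  rw [← integral_smul]
  refine integral_congr_ae ?_
  filter_upwards [ae_coeFn_smul c u] with t ht
  simp only [ht]
  rw [smul_comm]

theorem mem_weakDerivGraph_one {u g : L2w κ H} : (u, g) ∈ weakDerivGraph κ H 1 ↔
    ∀ φ : ℝ → ℝ, IsTest φ → ∫ t in Ioi 0, deriv φ t • u t = -∫ t in Ioi 0, φ t • g t := by
  change (∀ φ : ℝ → ℝ, IsTest φ → ∫ t in Ioi 0, iteratedDeriv 1 φ t • u t =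
    (-1 : ℝ) ^ 1 • ∫ t in Ioi 0, φ t • g t) ↔ _
  simp only [iteratedDeriv_one, pow_one, neg_smul, one_smul]

theorem mem_weakDerivGraph_succ {n : ℕ} {u v g : L2w κ H} (h : (u, v) ∈ weakDerivGraph κ H 1)
    (h' : (v, g) ∈ weakDerivGraph κ H n) : (u, g) ∈ weakDerivGraph κ H (n + 1) := by
  intro φ hφ
  have h1 := mem_weakDerivGraph_one.mp h _ (hφ.iteratedDeriv n)
  rw [iteratedDeriv_succ]
  refine h1.trans ?_
  have h2 : ∫ t in Ioi 0, iteratedDeriv n φ t • v t = (-1 : ℝ) ^ n • ∫ t in Ioi 0, φ t • g t :=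
    h' φ hφ
  rw [h2, pow_succ, mul_neg, mul_one, neg_smul]

theorem ae_eq_zero_of_forall_test [CompleteSpace H] {z : ℝ → H} (hz : LocInt z)
    (h : ∀ φ, IsTest φ → ∫ t in Ioi 0, φ t • z t = 0) :
    ∀ᵐ t ∂volume.restrict (Ioi (0 : ℝ)), z t = 0 := by
  have hloc : LocallyIntegrableOn z (Ioi (0 : ℝ)) := by
    rw [locallyIntegrableOn_iff isOpen_Ioi.isLocallyClosed]
    intro K hK hKc
    obtain ⟨b, hb⟩ := hKc.bddAbove
    exact (hz b).mono_set fun t ht => ⟨hK ht, hb ht⟩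
  rw [ae_restrict_iff' measurableSet_Ioi]
  refine isOpen_Ioi.ae_eq_zero_of_integral_contDiff_smul_eq_zero hloc fun φ hφ hc hs => ?_
  rw [← h φ ⟨hφ, hc, hs⟩]
  refine (setIntegral_eq_integral_of_forall_compl_eq_zero fun t ht => ?_).symm
  rw [image_eq_zero_of_notMem_tsupport fun h => ht (hs h), zero_smul]

theorem iteratedDeriv_comp_sub (n : ℕ) (φ : ℝ → ℝ) (T : ℝ) :
    iteratedDeriv n (fun t => φ (t - T)) = fun t => iteratedDeriv n φ (t - T) := by
  induction n with
  | zero => simp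
  | succ n ih =>
    rw [iteratedDeriv_succ, iteratedDeriv_succ, ih]
    funext t
    exact deriv_comp_sub_const _ _ _

/-- An integrable function on the half-line with a vanishing weak derivative is zero. -/
theorem ae_eq_zero_of_forall_iteratedDeriv [CompleteSpace H] {z : ℝ → H}
    (hz : IntegrableOn z (Ioi 0)) (n : ℕ)
    (h : ∀ φ, IsTest φ → ∫ t in Ioi 0, iteratedDeriv n φ t • z t = 0) :
    ∀ᵐ t ∂volume.restrict (Ioi (0 : ℝ)), z t = 0 := by
  induction n with
  | zero =>
    exact ae_eq_zero_of_forall_test (fun T => hz.mono_set Ioc_subset_Ioi_self) (by simpa using h)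
  | succ n ih =>
    -- By hypothesis the pairing of z with φ⁽ⁿ⁾ does not change when φ is translated to the right;
    -- integrability of z makes it tend to 0 under translation to infinity.
    refine ih fun φ hφ => ?_
    have hc := hφ.continuous_iteratedDeriv n
    obtain ⟨C, hC⟩ := (hφ.hasCompactSupport_iteratedDeriv n).exists_bound_of_continuous hc
    have hint : ∀ T : ℝ, IntegrableOn (fun t => iteratedDeriv n φ (t - T) • z t) (Ioi 0) := fun T =>
      Integrable.bdd_smul (𝕜 := ℝ) hz C
        (show Continuous fun t => iteratedDeriv n φ (t - T) by fun_prop).aestronglyMeasurable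
        (ae_of_all _ fun t => hC (t - T))
    have heq : ∀ T : ℝ, 0 ≤ T → ∫ t in Ioi 0, iteratedDeriv n φ (t - T) • z t =
        ∫ t in Ioi 0, iteratedDeriv n φ t • z t := fun T hT => by
      obtain ⟨θ, hθ, hd⟩ := hφ.exists_deriv_eq_sub_translate hT
      have h1 := h θ hθ
      rw [iteratedDeriv_succ', hd] at h1
      have h2 : iteratedDeriv n (fun t => φ t - φ (t - T)) =
          fun t => iteratedDeriv n φ t - iteratedDeriv n φ (t - T) := by
        funext t
        have hn : ContDiff ℝ n φ := hφ.1.of_le (mod_cast le_top)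
        have hn' : ContDiff ℝ n fun t => φ (t - T) := hn.comp (by fun_prop)
        rw [iteratedDeriv_fun_sub hn.contDiffAt hn'.contDiffAt, iteratedDeriv_comp_sub]
      simp only [h2, sub_smul] at h1
      have h3 := hint 0
      simp only [sub_zero] at h3
      rw [integral_sub h3 (hint T)] at h1
      exact (sub_eq_zero.mp h1).symm
    have hlim : Tendsto (fun T : ℝ => ∫ t in Ioi 0, iteratedDeriv n φ (t - T) • z t) atTop (𝓝 0) := by
      rw [← integral_zero (α := ℝ) (G := H) (μ := volume.restrict (Ioi 0))]
      refine tendsto_integral_filter_of_dominated_convergence (fun t => C * ‖z t‖)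
        (Eventually.of_forall fun T => (hint T).1) (Eventually.of_forall fun T =>
          ae_of_all _ fun t => ?_) (hz.norm.const_mul C) (ae_of_all _ fun t => ?_)
      · rw [norm_smul]
        gcongr
        exact hC _
      · refine tendsto_const_nhds.congr' ?_
        -- Pointwise the integrand is eventually zero, as t - T leaves the open half-line carrying
        -- the support.
        filter_upwards [eventually_ge_atTop t] with T hT
        rw [(hφ.iteratedDeriv n).eq_zero_of_nonpos (sub_nonpos.mpr hT), zero_smul]
    refine tendsto_nhds_unique (tendsto_const_nhds.congr' ?_) hlim
    filter_upwards [eventually_ge_atTop 0] with T hT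
    exact (heq T hT).symm

theorem integral_deriv_smul_prim [CompleteSpace H] {φ : ℝ → ℝ} (hφ : IsTest φ) {g : ℝ → H}
    (hg : LocInt g) : ∫ t in Ioi 0, deriv φ t • prim g t = -∫ t in Ioi 0, φ t • g t := by
  obtain ⟨a, b, ha, hab, h0⟩ := hφ.exists_bounds
  obtain ⟨a', b', ha', hab', h0'⟩ := hφ.deriv.exists_bounds
  set T := max b b' + 1 with hT
  have hbT : b < T := by linarith [le_max_left b b']
  have hbT' : b' < T := by linarith [le_max_right b b']
  have hTp : 0 ≤ T := by linarith
  have h1 : ∀ ψ : ℝ → ℝ, ∀ v : ℝ → H, (∀ t, T < t → ψ t = 0) →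
      ∫ t in Ioi 0, ψ t • v t = ∫ t in Ioc 0 T, ψ t • v t := fun ψ v hψ => by
    refine setIntegral_eq_of_subset_of_forall_sdiff_eq_zero measurableSet_Ioi Ioc_subset_Ioi_self
      fun t ht => ?_
    rw [hψ t (by by_contra hc; exact ht.2 ⟨ht.1, not_lt.mp hc⟩), zero_smul]
  rw [h1 _ _ fun t ht => h0' t fun h => by linarith [h.2],
    h1 _ _ fun t ht => h0 t fun h => by linarith [h.2], eq_neg_iff_add_eq_zero]
  have h2 := smul_prim (hφ.1.of_le (by simp)) hg hTp
  rw [h0 T fun h => by linarith [h.2], zero_smul] at h2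
  have i1 : LocInt fun t => deriv φ t • prim g t :=
    locInt_of_continuous (hφ.deriv.1.continuous.smul (continuous_prim hg))
  rw [h2]
  exact (prim_add i1 (hg.continuous_smul hφ.1.continuous) T).symm

theorem HasPrim.mem_weakDerivGraph [CompleteSpace H] {y g : L2w κ H} (h : HasPrim y g) :
    (y, g) ∈ weakDerivGraph κ H 1 := by
  rw [mem_weakDerivGraph_one]
  intro φ hφ
  rw [← integral_deriv_smul_prim hφ (locInt_L2w g)]
  refine integral_congr_ae ?_
  filter_upwards [h] with t ht
  rw [ht]

end

section

variable {H : Type*} [NormedAddCommGroup H] [InnerProductSpace ℂ H] {κ : ℝ}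

/-! ### The operator `(-d/dt + m)⁻¹` -/

theorem memLp_test_smul {χ : ℝ → ℝ} (hχ : IsTest χ) (h : H) :
    MemLp (fun t => χ t • h) 2 (wMeasure κ) := by
  have : IsLocallyFiniteMeasure (wMeasure κ) := by
    unfold wMeasure
    exact IsLocallyFiniteMeasure.withDensity_coe
      (f := fun t => Real.toNNReal (Real.exp (-κ * t))) (by fun_prop)
  have hc := hχ.1.continuous
  exact (hc.smul continuous_const).memLp_of_hasCompactSupport hχ.2.1.smul_right

/-- The function `t ↦ χ(t) h` for a test function `χ`. -/
def testVec (κ : ℝ) {χ : ℝ → ℝ} (hχ : IsTest χ) (h : H) : L2w κ H := (memLp_test_smul hχ h).toLp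

theorem testVec_ae {χ : ℝ → ℝ} (hχ : IsTest χ) (h : H) :
    ∀ᵐ t ∂volume.restrict (Ioi (0 : ℝ)), testVec κ hχ h t = χ t • h :=
  (ae_wMeasure_iff κ).mp (MemLp.coeFn_toLp _)

/-- Hölder in the weighted measure: the factor e^{(κ-m)t} belongs to L_{2,κ} because 2m - κ > 0.
This integrability supplies uniqueness for the backward equation without an initial condition. -/
theorem integrable_exp_smul_L2w {m : ℝ} (hm : 0 < 2 * (m - κ) + κ) (y : L2w κ H) :
    IntegrableOn (fun t => Real.exp (-m * t) • y t) (Ioi 0) := by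
  have h1 : MemLp (fun t => Real.exp ((κ - m) * t)) 2 (wMeasure κ) := by
    rw [memLp_two_iff_integrable_sq_norm (Continuous.aestronglyMeasurable (by fun_prop)),
      integrable_wMeasure_iff]
    have := exp_neg_integrableOn_Ioi 0 hm
    refine this.congr (ae_of_all _ fun t => ?_)
    simp only [Real.norm_of_nonneg (Real.exp_pos _).le, smul_eq_mul, pow_two]
    rw [← Real.exp_add, ← Real.exp_add]
    congr 1
    ring
  have h2 : Integrable (fun t => Real.exp ((κ - m) * t) • y t) (wMeasure κ) :=
    memLp_one_iff_integrable.mp (MemLp.smul (𝕜 := ℝ) (p := 2) (q := 2) (r := 1) (Lp.memLp y) h1)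
  rw [integrable_wMeasure_iff] at h2
  refine h2.congr (ae_of_all _ fun t => ?_)
  simp only [smul_smul]
  rw [← Real.exp_add]
  congr 2
  ring

section Complete

variable [CompleteSpace H]

theorem inner_testVec {χ : ℝ → ℝ} (hχ : IsTest χ) (h : H) (u : L2w κ H) :
    inner ℂ (testVec κ hχ h) u = inner ℂ h (∫ t in Ioi 0, (Real.exp (-κ * t) * χ t) • u t) := by
  have he : IsTest fun t => Real.exp (-κ * t) * χ t := hχ.mul_left (by fun_prop)
  rw [← integral_inner (he.integrable_smul u), L2.inner_def, integral_wMeasure]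
  refine integral_congr_ae ?_
  filter_upwards [testVec_ae (κ := κ) hχ h] with t ht
  rw [ht, ← Complex.coe_smul, ← Complex.coe_smul, ← Complex.coe_smul, inner_smul_left,
    inner_smul_right, Complex.conj_ofReal]
  push_cast
  rw [smul_eq_mul, mul_assoc]

theorem hasPrim_testVec {χ : ℝ → ℝ} (hχ : IsTest χ) (h : H) :
    HasPrim (testVec κ hχ h) (testVec κ hχ.deriv h) := by
  filter_upwards [testVec_ae hχ h, ae_restrict_mem measurableSet_Ioi] with t h1 ht
  rw [h1, prim_congr_ae (testVec_ae hχ.deriv h), prim, integral_smul_const]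
  have h2 := prim_deriv (hχ.1.of_le (by simp)) (le_of_lt ht)
  rw [hχ.eq_zero_of_nonpos le_rfl, sub_zero] at h2
  rw [← h2, prim]

variable {m : ℝ} (hm : 0 < 2 * (m - κ) + κ)

/-- The operator `(-d/dt + m)⁻¹` in `L_{2,κ}`. -/
def antiVolterra (m : ℝ) (hm : 0 < 2 * (m - κ) + κ) : L2w κ H →L[ℂ] L2w κ H :=
  ContinuousLinearMap.adjoint (volterra (m - κ) hm)

theorem re_inner_antiVolterra_nonneg (f : L2w κ H) : 0 ≤ (inner ℂ (antiVolterra m hm f) f).re := by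
  rw [antiVolterra, ContinuousLinearMap.adjoint_inner_left, ← inner_conj_symm, Complex.conj_re]
  exact re_inner_volterra_nonneg hm f

theorem lift_antiVolterra {T : H →L[ℂ] H} (hT : ∀ x y, inner ℂ (T x) y = inner ℂ x (T y))
    (f : L2w κ H) : lift κ T (antiVolterra m hm f) = antiVolterra m hm (lift κ T f) := by
  refine ext_inner_right ℂ fun g => ?_
  rw [lift_symm hT, antiVolterra, ContinuousLinearMap.adjoint_inner_left,
    ContinuousLinearMap.adjoint_inner_left, lift_symm hT, lift_volterra]

/-- Weak form of (-d/dt + m) V f = f. Integrating by parts against e^{-κt} adds κ to -d/dt, which is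
why the adjoint of the inverse of d/dt + (m - κ) is the right operator. -/
theorem integral_antiVolterra (f : L2w κ H) {φ : ℝ → ℝ} (hφ : IsTest φ) :
    ∫ t in Ioi 0, (deriv φ t + m * φ t) • antiVolterra m hm f t = ∫ t in Ioi 0, φ t • f t := by
  refine ext_inner_left ℂ fun h => ?_
  -- The factor e^{κt} cancels the weight in the inner product.
  have hθ : IsTest fun t => Real.exp (κ * t) * φ t := hφ.mul_left (by fun_prop)
  have h1 := volterra_of_hasPrim hm (hasPrim_testVec (κ := κ) hθ h)
  have h2 : inner ℂ (testVec κ hθ.deriv h + ((m - κ : ℝ) : ℂ) • testVec κ hθ h)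
      (antiVolterra m hm f) = inner ℂ (testVec κ hθ h) f := by
    rw [antiVolterra, ContinuousLinearMap.adjoint_inner_right, h1]
  have he : ∀ t, Real.exp (-κ * t) * (Real.exp (κ * t) * φ t) = φ t := fun t => by
    rw [← mul_assoc, ← Real.exp_add]; simp
  have hd : ∀ t, Real.exp (-κ * t) * deriv (fun t => Real.exp (κ * t) * φ t) t =
      deriv φ t + κ * φ t := fun t => by
    have hd1 : deriv (fun t => Real.exp (κ * t)) t = κ * Real.exp (κ * t) :=
      congrFun (exp_deriv κ) t
    have hd2 : DifferentiableAt ℝ (fun t => Real.exp (κ * t)) t := by fun_prop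
    rw [deriv_fun_mul hd2 (hφ.1.differentiable (by simp) t), hd1]
    have h0 : Real.exp (-κ * t) * Real.exp (κ * t) = 1 := by rw [← Real.exp_add]; simp
    linear_combination (κ * φ t + deriv φ t) * h0
  rw [inner_add_left, inner_smul_left, Complex.conj_ofReal, inner_testVec, inner_testVec,
    inner_testVec] at h2
  simp only [he, hd] at h2
  rw [← h2, ← inner_smul_right, ← inner_add_right, Complex.coe_smul, ← integral_smul]
  have i1 := (hφ.deriv.add (hφ.mul_left (e := fun _ => κ) contDiff_const)).integrable_smul
    (antiVolterra m hm f)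
  have i2 : Integrable (fun t => (m - κ) • φ t • antiVolterra m hm f t) (volume.restrict (Ioi 0)) :=
    (hφ.integrable_smul (antiVolterra m hm f)).smul (m - κ)
  rw [← integral_add i1 i2]
  congr 1
  refine integral_congr_ae (ae_of_all _ fun t => ?_)
  simp only
  rw [smul_smul, ← add_smul]
  congr 1
  ring

theorem antiVolterra_mem_weakDerivGraph (f : L2w κ H) :
    (antiVolterra m hm f, (m : ℂ) • antiVolterra m hm f - f) ∈ weakDerivGraph κ H 1 := by
  rw [mem_weakDerivGraph_one]
  intro φ hφ
  rw [hφ.integral_smul_sub, ← integral_antiVolterra hm f hφ, integral_smul_smul,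
    Complex.coe_smul, ← integral_smul]
  have i1 := hφ.deriv.integrable_smul (antiVolterra m hm f)
  have i2 : Integrable (fun t => m • φ t • antiVolterra m hm f t) (volume.restrict (Ioi 0)) :=
    (hφ.integrable_smul (antiVolterra m hm f)).smul m
  simp only [add_smul, mul_smul]
  rw [integral_add i1 i2]
  abel

/-- The operator `d/dt + m` on functions. -/
def shiftDeriv (m : ℝ) (φ : ℝ → ℝ) (t : ℝ) : ℝ := deriv φ t + m * φ t

theorem IsTest.shiftDeriv {φ : ℝ → ℝ} (h : IsTest φ) (m : ℝ) : IsTest (shiftDeriv m φ) :=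
  h.deriv.add (h.mul_left (e := fun _ => m) contDiff_const)

theorem IsTest.shiftDeriv_iterate {φ : ℝ → ℝ} (h : IsTest φ) (m : ℝ) (n : ℕ) :
    IsTest ((WeightedODE.shiftDeriv m)^[n] φ) := by
  induction n with
  | zero => exact h
  | succ n ih => rw [Function.iterate_succ_apply']; exact ih.shiftDeriv m

theorem deriv_shiftDeriv {φ : ℝ → ℝ} (h : IsTest φ) (m : ℝ) :
    deriv (shiftDeriv m φ) = shiftDeriv m (deriv φ) := by
  funext t
  have h1 := h.deriv.1.differentiable (by simp) t
  have h2 := h.1.differentiable (by simp) t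
  change deriv (fun t => deriv φ t + m * φ t) t = _
  rw [deriv_fun_add h1 (h2.const_mul m), deriv_const_mul _ h2]
  rfl

theorem deriv_shiftDeriv_iterate {φ : ℝ → ℝ} (h : IsTest φ) (m : ℝ) (n : ℕ) :
    deriv ((shiftDeriv m)^[n] φ) = (shiftDeriv m)^[n] (deriv φ) := by
  induction n with
  | zero => rfl
  | succ n ih =>
    rw [Function.iterate_succ_apply', Function.iterate_succ_apply',
      deriv_shiftDeriv (h.shiftDeriv_iterate m n), ih]

theorem shiftDeriv_iterate_exp {ψ : ℝ → ℝ} (h : IsTest ψ) (m : ℝ) (n : ℕ) :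
    (shiftDeriv m)^[n] (fun t => Real.exp (-m * t) * ψ t) =
      fun t => Real.exp (-m * t) * iteratedDeriv n ψ t := by
  induction n with
  | zero => simp
  | succ n ih =>
    rw [Function.iterate_succ_apply', ih]
    funext t
    have hd1 : deriv (fun t => Real.exp (-m * t)) t = -m * Real.exp (-m * t) :=
      congrFun (exp_deriv (-m)) t
    have hd2 : DifferentiableAt ℝ (fun t => Real.exp (-m * t)) t := by fun_prop
    rw [shiftDeriv, deriv_fun_mul hd2 ((h.iteratedDeriv n).1.differentiable (by simp) t), hd1,
      iteratedDeriv_succ]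
    ring

/-- `(-d/dt + m)⁻ⁿ dⁿ/dtⁿ = (m (-d/dt + m)⁻¹ - 1)ⁿ`. -/
theorem antiVolterra_pow_weakDeriv {n : ℕ} {u g : L2w κ H} (h : (u, g) ∈ weakDerivGraph κ H n) :
    (antiVolterra m hm ^ n) g =
      (((m : ℂ) • antiVolterra m hm - 1 : L2w κ H →L[ℂ] L2w κ H) ^ n) u := by
  set V : L2w κ H →L[ℂ] L2w κ H := antiVolterra m hm with hV
  set X : L2w κ H →L[ℂ] L2w κ H := (m : ℂ) • V - 1 with hX
  -- Both sides of the claim are tested against (d/dt + m)ⁿ φ, the transposed operator of (-d/dt +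
  -- m)ⁿ.
  have h1 : ∀ k (f : L2w κ H) (φ : ℝ → ℝ), IsTest φ →
      ∫ t in Ioi 0, (shiftDeriv m)^[k] φ t • (V ^ k) f t = ∫ t in Ioi 0, φ t • f t := by
    intro k
    induction k with
    | zero => intro f φ _; simp
    | succ k ih =>
      intro f φ hφ
      rw [Function.iterate_succ_apply', pow_succ']
      exact (integral_antiVolterra hm ((V ^ k) f) (hφ.shiftDeriv_iterate m k)).trans (ih f φ hφ)
  have hstep : ∀ (v : L2w κ H) (φ : ℝ → ℝ), IsTest φ →
      ∫ t in Ioi 0, shiftDeriv m φ t • X v t = -∫ t in Ioi 0, deriv φ t • v t := by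
    intro v φ hφ
    have e1 : X v = (m : ℂ) • V v - v := rfl
    have e2 := integral_antiVolterra hm v hφ
    have i1 := hφ.deriv.integrable_smul v
    have i2 : Integrable (fun t => m • φ t • v t) (volume.restrict (Ioi 0)) :=
      (hφ.integrable_smul v).smul m
    rw [e1, (hφ.shiftDeriv m).integral_smul_sub, integral_smul_smul]
    simp only [shiftDeriv, hV]
    rw [e2]
    simp only [add_smul, mul_smul]
    rw [integral_add i1 i2]
    rw [integral_smul, Complex.coe_smul]
    abel
  have h2 : ∀ k (φ : ℝ → ℝ), IsTest φ →
      ∫ t in Ioi 0, (shiftDeriv m)^[k] φ t • (X ^ k) u t =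
        (-1 : ℝ) ^ k • ∫ t in Ioi 0, iteratedDeriv k φ t • u t := by
    intro k
    induction k with
    | zero => intro φ _; simp
    | succ k ih =>
      intro φ hφ
      rw [Function.iterate_succ_apply', pow_succ']
      refine (hstep ((X ^ k) u) _ (hφ.shiftDeriv_iterate m k)).trans ?_
      rw [deriv_shiftDeriv_iterate hφ, ih _ hφ.deriv, ← iteratedDeriv_succ', pow_succ, mul_neg,
        mul_one, neg_smul]
  set y := (V ^ n) g - (X ^ n) u with hy
  have hz : ∀ᵐ t ∂volume.restrict (Ioi (0 : ℝ)), Real.exp (-m * t) • y t = 0 := by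
    -- Taking φ = e^{-mt} ψ conjugates d/dt + m into d/dt, so the integrable function e^{-mt} y has
    -- vanishing n-th weak derivative.
    refine ae_eq_zero_of_forall_iteratedDeriv (integrable_exp_smul_L2w hm y) n fun ψ hψ => ?_
    have hφ : IsTest fun t => Real.exp (-m * t) * ψ t := hψ.mul_left (by fun_prop)
    have e1 := h1 n g _ hφ
    have e2 := h2 n _ hφ
    have e3 : ∫ t in Ioi 0, iteratedDeriv n (fun t => Real.exp (-m * t) * ψ t) t • u t =
      (-1 : ℝ) ^ n • ∫ t in Ioi 0, (Real.exp (-m * t) * ψ t) • g t := h _ hφ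
    rw [e3, smul_smul, ← mul_pow, neg_one_mul, neg_neg, one_pow, one_smul] at e2
    have e4 := (hφ.shiftDeriv_iterate m n).integral_smul_sub ((V ^ n) g) ((X ^ n) u)
    rw [e1, e2, sub_self, shiftDeriv_iterate_exp hψ] at e4
    rw [← e4]
    refine integral_congr_ae (ae_of_all _ fun t => ?_)
    simp only [smul_smul, mul_comm, hy]
  refine sub_eq_zero.mp ((Lp.eq_zero_iff_ae_eq_zero).mpr ((ae_wMeasure_iff κ).mpr ?_))
  filter_upwards [hz] with t ht
  exact (smul_eq_zero.mp ht).resolve_left (Real.exp_pos _).ne'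

theorem antiVolterra_of_weakDeriv {u g : L2w κ H} (h : (u, g) ∈ weakDerivGraph κ H 1) :
    antiVolterra m hm ((m : ℂ) • u - g) = u := by
  have h1 := antiVolterra_pow_weakDeriv hm h
  rw [pow_one, pow_one] at h1
  rw [map_sub, map_smul, h1]
  exact sub_sub_cancel _ _

end Complete

end

section

variable {H : Type*} [NormedAddCommGroup H] [InnerProductSpace ℂ H] {κ : ℝ}

/-! ### Initial values -/

theorem integral_translate_smul {ψ : ℝ → ℝ} (hψ : IsTest ψ) (z : ℝ → H) {T : ℝ} (hT : 0 ≤ T) :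
    ∫ t in Ioi 0, ψ (t - T) • z t = ∫ t in Ioi 0, ψ t • z (t + T) := by
  rw [setIntegral_eq_integral_of_forall_compl_eq_zero fun t ht => by
      rw [hψ.eq_zero_of_nonpos (by have := notMem_Ioi.mp ht; linarith), zero_smul],
    setIntegral_eq_integral_of_forall_compl_eq_zero fun t ht => by
      rw [hψ.eq_zero_of_nonpos (notMem_Ioi.mp ht), zero_smul],
    ← integral_sub_right_eq_self (fun t => ψ t • z (t + T)) T]
  simp only [sub_add_cancel]

theorem HasPrim.add {y g y' g' : L2w κ H} (h : HasPrim y g) (h' : HasPrim y' g') :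
    HasPrim (y + y') (g + g') := by
  filter_upwards [h, h', ae_coeFn_add y y'] with t h1 h2 h3
  rw [h3, h1, h2, prim_congr_ae (ae_coeFn_add g g'), prim_add (locInt_L2w g) (locInt_L2w g')]

variable [CompleteSpace H]

/-- A continuous function with vanishing weak derivative is constant. -/
theorem eq_of_forall_integral_deriv_smul {z : ℝ → H} (hz : Continuous z)
    (h : ∀ φ, IsTest φ → ∫ t in Ioi 0, deriv φ t • z t = 0) {T : ℝ} (hT : 0 ≤ T) : z T = z 0 := by
  have hz' : Continuous fun t => z (t + T) := by fun_prop
  have hae := ae_eq_zero_of_forall_test (z := fun t => z (t + T) - z t)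
    (locInt_of_continuous (hz'.sub hz)) fun ψ hψ => by
    obtain ⟨θ, hθ, hd⟩ := hψ.exists_deriv_eq_sub_translate hT
    have h1 := h θ hθ
    have hc := hψ.1.continuous
    have i0 : ∀ v : ℝ → H, Continuous v → Integrable (fun t => ψ t • v t) := fun v hv =>
      (hc.smul hv).integrable_of_hasCompactSupport hψ.2.1.smul_right
    have i1 : Integrable (fun t => ψ (t - T) • z t) := by
      have := (i0 _ hz').comp_sub_right T
      simpa only [sub_add_cancel] using this
    rw [hd] at h1
    simp only [sub_smul] at h1
    rw [integral_sub (i0 z hz).restrict i1.restrict, integral_translate_smul hψ z hT] at h1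
    simp only [smul_sub]
    rw [integral_sub (i0 _ hz').restrict (i0 z hz).restrict, ← sub_eq_zero.mp h1, sub_self]
  have heq : EqOn (fun t => z (t + T)) z (Ioi 0) := by
    refine Measure.eqOn_open_of_ae_eq (μ := volume) ?_ isOpen_Ioi hz'.continuousOn hz.continuousOn
    filter_upwards [hae] with t ht
    exact sub_eq_zero.mp ht
  have hcl := heq.closure hz' hz
  have h0 : (0 : ℝ) ∈ closure (Ioi 0) := by rw [closure_Ioi]; exact self_mem_Ici
  simpa using hcl h0

/-- The difference of c and the primitive of g is continuous with zero weak derivative, hence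
constant, and it vanishes at 0. Precomposition with max t 0 only serves to make c continuous on the
whole line. -/
theorem hasPrim_of_continuous {y g : L2w κ H} (h : (y, g) ∈ weakDerivGraph κ H 1) {c : ℝ → H}
    (hc : ContinuousOn c (Ici 0)) (hc0 : c 0 = 0)
    (hy : ∀ᵐ t ∂volume.restrict (Ioi (0 : ℝ)), y t = c t) : HasPrim y g := by
  have hg := locInt_L2w g
  set z : ℝ → H := fun t => c (max t 0) - prim g t with hz
  have hcc : Continuous fun t : ℝ => c (max t 0) :=
    hc.comp_continuous (by fun_prop) fun t => le_max_right t 0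
  have hzc : Continuous z := hcc.sub (continuous_prim hg)
  have hmax : ∀ᵐ t ∂volume.restrict (Ioi (0 : ℝ)), c (max t 0) = y t := by
    filter_upwards [hy, ae_restrict_mem measurableSet_Ioi] with t h1 ht
    rw [max_eq_left (le_of_lt ht), h1]
  have hconst : ∀ T, 0 ≤ T → z T = z 0 := fun T hT =>
    eq_of_forall_integral_deriv_smul hzc (fun φ hφ => by
      have h1 := mem_weakDerivGraph_one.mp h φ hφ
      have i1 : Integrable (fun t => deriv φ t • prim g t) :=
        (hφ.deriv.1.continuous.smul
          (continuous_prim hg)).integrable_of_hasCompactSupport hφ.deriv.2.1.smul_right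
      rw [← integral_deriv_smul_prim hφ hg, ← sub_eq_zero,
        ← integral_sub (hφ.deriv.integrable_smul y) i1.restrict] at h1
      rw [← h1]
      refine integral_congr_ae ?_
      filter_upwards [hmax] with t ht
      rw [hz, ← smul_sub, ← ht]) hT
  have hz0 : z 0 = 0 := by simp [hz, prim_zero, hc0]
  filter_upwards [hmax, ae_restrict_mem measurableSet_Ioi] with t h1 ht
  have h2 := hconst t (le_of_lt ht)
  rw [hz0] at h2
  rw [← h1]
  exact sub_eq_zero.mp h2

/-- The weak derivative of a continuously differentiable function is its derivative. -/
theorem ae_eq_derivWithin {y g : L2w κ H} (h : (y, g) ∈ weakDerivGraph κ H 1) {c : ℝ → H}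
    (hc : ContDiffOn ℝ 1 c (Ici 0)) (hc0 : c 0 = 0)
    (hy : ∀ᵐ t ∂volume.restrict (Ioi (0 : ℝ)), y t = c t) :
    ∀ᵐ t ∂volume.restrict (Ioi (0 : ℝ)), g t = derivWithin c (Ici 0) t := by
  have hd : ContinuousOn (derivWithin c (Ici 0)) (Ici 0) :=
    hc.continuousOn_derivWithin (uniqueDiffOn_Ici 0) le_rfl
  have hLI : LocInt (derivWithin c (Ici 0)) := fun T =>
    ((hd.mono Icc_subset_Ici_self).integrableOn_Icc).mono_set Ioc_subset_Icc_self
  have hp : ∀ t, 0 ≤ t → prim (derivWithin c (Ici 0)) t = c t := fun t ht => by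
    rw [prim_eq_intervalIntegral _ ht, intervalIntegral.integral_eq_sub_of_hasDerivAt_of_le ht
      (hc.continuousOn.mono Icc_subset_Ici_self) (fun s hs => ?_)
      ((hd.mono ((uIcc_of_le ht).trans_subset Icc_subset_Ici_self)).intervalIntegrable), hc0, sub_zero]
    exact ((hc.differentiableOn (by simp) s hs.1.le).hasDerivWithinAt).hasDerivAt (Ici_mem_nhds hs.1)
  have hae := ae_eq_zero_of_forall_test (z := fun t => g t - derivWithin c (Ici 0) t)
    (fun T => (locInt_L2w g T).sub (hLI T)) fun φ hφ => by
    have h1 := mem_weakDerivGraph_one.mp h φ hφ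
    have h2 := integral_deriv_smul_prim hφ hLI
    have h3 : ∫ t in Ioi 0, deriv φ t • y t =
        ∫ t in Ioi 0, deriv φ t • prim (derivWithin c (Ici 0)) t := by
      refine integral_congr_ae ?_
      filter_upwards [hy, ae_restrict_mem measurableSet_Ioi] with t h4 ht
      rw [h4, hp t (le_of_lt ht)]
    rw [h1, h2, neg_inj] at h3
    have i2 : IntegrableOn (fun t => φ t • derivWithin c (Ici 0) t) (Ioi 0) := by
      obtain ⟨a, b, ha, hab, h0⟩ := hφ.exists_bounds
      have := (hLI.continuous_smul hφ.1.continuous) b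
      refine (integrableOn_iff_integrable_of_support_subset ?_).mpr
        ((integrableOn_iff_integrable_of_support_subset (s := Ioc 0 b) ?_).mp this) |>.mono_set
          (subset_refl _)
      all_goals
        intro t ht
        have hmem : t ∈ Icc a b := by
          by_contra hcon
          exact ht (by simp only [h0 t hcon, zero_smul])
        first
          | exact ⟨ha.trans_le hmem.1, hmem.2⟩
          | exact ha.trans_le hmem.1
    simp only [smul_sub]
    rw [integral_sub (hφ.integrable_smul g) i2, h3, sub_self]
  filter_upwards [hae] with t ht
  exact sub_eq_zero.mp ht

/-- The derivatives of an element of `L_{2,κ}` with a `C²` representative that vanishes to second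
order at `0`. -/
theorem hasPrim_of_contDiffOn {u u1 u2 u3 : L2w κ H} (h1 : (u, u1) ∈ weakDerivGraph κ H 1)
    (h2 : (u1, u2) ∈ weakDerivGraph κ H 1) (h3 : (u2, u3) ∈ weakDerivGraph κ H 1) {w : ℝ → H}
    (hw : ∀ᵐ t ∂volume.restrict (Ioi (0 : ℝ)), u t = w t) (hc : ContDiffOn ℝ 2 w (Ici 0))
    (h0 : ∀ s : ℕ, s ≤ 2 → iteratedDerivWithin s w (Ici 0) 0 = 0) :
    HasPrim u u1 ∧ HasPrim u1 u2 ∧ HasPrim u2 u3 := by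
  set w1 := derivWithin w (Ici 0) with hw1
  set w2 := derivWithin w1 (Ici 0) with hw2
  have hz0 : w 0 = 0 := by simpa using h0 0 (by norm_num)
  have hz1 : w1 0 = 0 := by simpa [iteratedDerivWithin_one] using h0 1 (by norm_num)
  have hz2 : w2 0 = 0 := by
    have h := h0 2 le_rfl
    rw [iteratedDerivWithin_succ, iteratedDerivWithin_one] at h
    exact h
  have hc1 : ContDiffOn ℝ 1 w1 (Ici 0) :=
    hc.derivWithin (uniqueDiffOn_Ici 0) (by norm_num [one_add_one_eq_two])
  have hc2 : ContinuousOn w2 (Ici 0) := hc1.continuousOn_derivWithin (uniqueDiffOn_Ici 0) le_rfl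
  have e1 := ae_eq_derivWithin h1 (hc.of_le one_le_two) hz0 hw
  have e2 := ae_eq_derivWithin h2 hc1 hz1 e1
  -- No third classical derivative is available: for u2 the continuous representative w2 with w2(0)
  -- = 0 suffices.
  exact ⟨hasPrim_of_continuous h1 hc.continuousOn hz0 hw,
    hasPrim_of_continuous h2 hc1.continuousOn hz1 e1, hasPrim_of_continuous h3 hc2 hz2 e2⟩

theorem hasDerivAt_integral_of_continuous {g : ℝ → H} (hg : Continuous g) (t : ℝ) :
    HasDerivAt (fun t => ∫ s in (0 : ℝ)..t, g s) (g t) t :=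
  intervalIntegral.integral_hasDerivAt_right (hg.intervalIntegrable 0 t)
    (hg.stronglyMeasurableAtFilter _ _) hg.continuousAt

theorem exists_contDiffOn_rep {u u1 u2 u3 : L2w κ H} (h1 : HasPrim u u1) (h2 : HasPrim u1 u2)
    (h3 : HasPrim u2 u3) : ∃ w : ℝ → H, w =ᵐ[wMeasure κ] u ∧ ContDiffOn ℝ 2 w (Ici 0) ∧
      ∀ s : ℕ, s ≤ 2 → iteratedDerivWithin s w (Ici 0) 0 = 0 := by
  set c2 : ℝ → H := prim u3 with hc2
  have hc2c : Continuous c2 := continuous_prim (locInt_L2w u3)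
  -- Oriented integrals over all of ℝ are used for the outer two integrations to obtain a function
  -- that is C² on the line; the innermost primitive needs only continuity.
  set w1 : ℝ → H := fun t => ∫ s in (0 : ℝ)..t, c2 s with hw1
  have hd1 := hasDerivAt_integral_of_continuous hc2c
  have hw1c : Continuous w1 := continuous_iff_continuousAt.mpr fun t => (hd1 t).continuousAt
  set w : ℝ → H := fun t => ∫ s in (0 : ℝ)..t, w1 s with hw
  have hd := hasDerivAt_integral_of_continuous hw1c
  have ed1 : deriv w1 = c2 := funext fun t => (hd1 t).deriv
  have ed : deriv w = w1 := funext fun t => (hd t).deriv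
  have hcd1 : ContDiff ℝ 1 w1 := contDiff_one_iff_deriv.mpr
    ⟨fun t => (hd1 t).differentiableAt, by rwa [ed1]⟩
  have hcd : ContDiff ℝ 2 w := by
    rw [← one_add_one_eq_two, contDiff_succ_iff_deriv]
    exact ⟨fun t => (hd t).differentiableAt, by simp, by rwa [ed]⟩
  have a1 : ∀ᵐ t ∂volume.restrict (Ioi (0 : ℝ)), u1 t = w1 t := by
    filter_upwards [h2, ae_restrict_mem measurableSet_Ioi] with t ht htp
    rw [ht, prim_congr_ae h3, prim_eq_intervalIntegral _ (le_of_lt htp)]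
  refine ⟨w, (ae_wMeasure_iff κ).mpr ?_, hcd.contDiffOn, fun s hs => ?_⟩
  · filter_upwards [h1, ae_restrict_mem measurableSet_Ioi] with t ht htp
    rw [ht, prim_congr_ae a1, prim_eq_intervalIntegral _ (le_of_lt htp)]
  · rw [iteratedDerivWithin_eq_iteratedDeriv (uniqueDiffOn_Ici 0)
      ((hcd.of_le (mod_cast hs)).contDiffAt) self_mem_Ici]
    interval_cases s
    · simp [hw]
    · rw [iteratedDeriv_one, ed]; simp [hw1]
    · rw [iteratedDeriv_succ, iteratedDeriv_one, ed, ed1, hc2, prim_zero]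

/-! ### Bounded operators and derivatives -/

theorem lift_prim (T : H →L[ℂ] H) (g : L2w κ H) (t : ℝ) : prim (lift κ T g) t = T (prim g t) := by
  rw [prim_congr_ae (lift_ae T g)]
  exact prim_clm (T.restrictScalars ℝ) (locInt_L2w g) t

theorem HasPrim.lift {y g : L2w κ H} (h : HasPrim y g) (T : H →L[ℂ] H) :
    HasPrim (lift κ T y) (lift κ T g) := by
  filter_upwards [h, lift_ae T y] with t h1 h2
  rw [h2, h1, lift_prim]

/-- With T = B this transfers a primitive relation between R x and R y to S x and S y, i.e. applies
A to it. -/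
theorem HasPrim.of_lift {T : H →L[ℂ] H} (hT : ∀ x, T x = 0 → x = 0) {y g : L2w κ H}
    (h : HasPrim (WeightedODE.lift κ T y) (WeightedODE.lift κ T g)) : HasPrim y g := by
  filter_upwards [h, lift_ae T y] with t h1 h2
  rw [h2, lift_prim] at h1
  exact sub_eq_zero.mp (hT _ (by rw [map_sub, h1, sub_self]))

theorem lift_mem_weakDerivGraph {u g : L2w κ H} (h : (u, g) ∈ weakDerivGraph κ H 1)
    (T : H →L[ℂ] H) : (lift κ T u, lift κ T g) ∈ weakDerivGraph κ H 1 := by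
  rw [mem_weakDerivGraph_one] at h ⊢
  intro φ hφ
  have hT : ∀ ψ : ℝ → ℝ, IsTest ψ → ∀ v : L2w κ H,
      ∫ t in Ioi 0, ψ t • lift κ T v t = T (∫ t in Ioi 0, ψ t • v t) := fun ψ hψ v => by
    rw [← T.integral_comp_comm (hψ.integrable_smul v)]
    refine integral_congr_ae ?_
    filter_upwards [lift_ae T v] with t ht
    rw [ht, ← Complex.coe_smul, ← Complex.coe_smul, map_smul]
  rw [hT _ hφ.deriv, hT _ hφ, h φ hφ, map_neg]

end

section

/-! ### Commuting resolvents -/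

section Algebra

variable {X : Type*} [NormedAddCommGroup X] [NormedSpace ℂ X]

/-- `1 - (S - 1)⁴`. -/
def remainderOp (S : X →L[ℂ] X) : X →L[ℂ] X := 1 - (S - 1) ^ 4

/-- The operator by which `A⁴ u` enters the representation of `u` by the resolvent. -/
def coeffA (S : X →L[ℂ] X) : X →L[ℂ] X := (4 - 6 * S + 4 * S ^ 2 - S ^ 3) ^ 4

/-- The operator by which the fourth derivative of `u` enters its representation by the
resolvent. -/
def coeffD (S : X →L[ℂ] X) : X →L[ℂ] X := ∑ i ∈ Finset.range 4, remainderOp S ^ i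

/-- Bezout identity for S⁴ and (S - 1)⁴. Put E = 1 - (S - 1)⁴ = K S with K = 4 - 6S + 4S² - S³. Then
1 = E⁴ + (1 + E + E² + E³)(1 - E) = K⁴ S⁴ + (1 + E + E² + E³)(S - 1)⁴. Applied to u, the hypotheses
replace S⁴ u and (S - 1)⁴ u by values of R⁴, which commutes with the coefficients. -/
theorem eq_pow_apply {R S : X →L[ℂ] X} (hc : Commute R S) {u g a : X}
    (hg : (R ^ 4) g = ((S - 1 : X →L[ℂ] X) ^ 4) u) (ha : (S ^ 4) u = (R ^ 4) a) :
    u = (R ^ 4) (coeffA S a + coeffD S g) := by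
  have hE : remainderOp S = (4 - 6 * S + 4 * S ^ 2 - S ^ 3) * S := by
    rw [remainderOp]
    noncomm_ring
  have hcS1 : Commute R (S - 1) := hc.sub_right (Commute.one_right R)
  have hcE : Commute R (remainderOp S) := (Commute.one_right R).sub_right (hcS1.pow_right 4)
  have hcK : Commute R (4 - 6 * S + 4 * S ^ 2 - S ^ 3) := by
    have h6 : Commute R (6 : X →L[ℂ] X) := Commute.ofNat_right R 6
    have h4 : Commute R (4 : X →L[ℂ] X) := Commute.ofNat_right R 4
    exact ((h4.sub_right (h6.mul_right hc)).add_right (h4.mul_right (hc.pow_right 2))).sub_right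
      (hc.pow_right 3)
  have hKS : Commute (4 - 6 * S + 4 * S ^ 2 - S ^ 3) S := by
    have h6 : Commute S (6 : X →L[ℂ] X) := Commute.ofNat_right S 6
    have h4 : Commute S (4 : X →L[ℂ] X) := Commute.ofNat_right S 4
    have hs : Commute S S := Commute.refl S
    exact (((h4.sub_right (h6.mul_right hs)).add_right (h4.mul_right (hs.pow_right 2))).sub_right
      (hs.pow_right 3)).symm
  have h1 : coeffD S * (S - 1) ^ 4 = 1 - coeffA S * S ^ 4 := by
    have h2 : (S - 1) ^ 4 = 1 - remainderOp S := by rw [remainderOp]; abel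
    rw [h2, coeffD, geom_sum_mul_neg, hE, hKS.mul_pow, coeffA]
  have c1 : Commute (R ^ 4) (coeffA S) := (hcK.pow_right 4).pow_left 4
  have c2 : Commute (R ^ 4) (coeffD S) :=
    Commute.pow_left (Commute.sum_right _ _ _ fun i _ => hcE.pow_right i) 4
  have e1 : (R ^ 4) (coeffA S a) = coeffA S ((S ^ 4) u) := by
    rw [ha]; exact DFunLike.congr_fun c1.eq a
  have e2 : (R ^ 4) (coeffD S g) = u - coeffA S ((S ^ 4) u) := by
    have e3 : (R ^ 4) (coeffD S g) = coeffD S ((R ^ 4) g) := DFunLike.congr_fun c2.eq g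
    rw [e3, hg]
    exact DFunLike.congr_fun h1 u
  rw [map_add, e1, e2]
  abel

/-- The relations between `B = A⁻¹`, a resolvent `R` and `S = A R`. -/
structure IsResolvent (B R S : X →L[ℂ] X) : Prop where
  inj : ∀ x, B x = 0 → x = 0
  left : ∀ f, B (S f) = R f
  right : ∀ f, S (B f) = R f

namespace IsResolvent

variable {B R S : X →L[ℂ] X}

theorem eq_of_apply_eq (h : IsResolvent B R S) {x y : X} (hxy : B x = B y) : x = y :=
  sub_eq_zero.mp (h.inj _ (by rw [map_sub, hxy, sub_self]))

theorem comm_B (h : IsResolvent B R S) (f : X) : R (B f) = B (R f) := by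
  rw [← h.left, h.right]

theorem comm (h : IsResolvent B R S) (f : X) : S (R f) = R (S f) := by
  rw [← h.right (S f), h.left]

end IsResolvent

end Algebra

variable {H : Type*} [NormedAddCommGroup H] [InnerProductSpace ℂ H] {κ : ℝ}

/-! ### Graphs of the operators of the problem -/

section Graphs

variable {A : H →ₗ.[ℂ] H} {B : H →L[ℂ] H}

theorem mem_opPow_graph (hB : ∀ x y, (x, y) ∈ A.graph ↔ x = B y) (n : ℕ) (x y : H) :
    (x, y) ∈ (opPow A n).graph ↔ x = (B ^ n) y := by
  induction n generalizing y with
  | zero =>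
    rw [opPow, LinearPMap.mem_graph_iff]
    constructor
    · rintro ⟨z, rfl, rfl⟩
      rfl
    · rintro rfl
      exact ⟨⟨_, trivial⟩, rfl, rfl⟩
  | succ n ih =>
    rw [opPow, mem_opComp_graph]
    constructor
    · rintro ⟨z, h1, h2⟩
      rw [(ih z).mp h1, (hB z y).mp h2, pow_succ]
      rfl
    · rintro rfl
      exact ⟨B y, (ih _).mpr rfl, (hB _ _).mpr rfl⟩

theorem mem_pointwiseGraph {T : H →ₗ.[ℂ] H} {C : H →L[ℂ] H}
    (hT : ∀ x y, (x, y) ∈ T.graph ↔ x = C y) {u v : L2w κ H} :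
    (u, v) ∈ pointwiseGraph κ T ↔ u = lift κ C v := by
  constructor
  · intro h
    refine L2w_ext ?_
    filter_upwards [(ae_wMeasure_iff κ).mp h, lift_ae C v] with t h1 h2
    rw [h2, (hT _ _).mp h1]
  · rintro rfl
    change ∀ᵐ t ∂wMeasure κ, _
    rw [ae_wMeasure_iff]
    filter_upwards [lift_ae C v] with t h2
    exact (hT _ _).mpr h2

theorem lift_pow (C : H →L[ℂ] H) (n : ℕ) (u : L2w κ H) : lift κ (C ^ n) u = (lift κ C ^ n) u := by
  induction n generalizing u with
  | zero =>
    refine L2w_ext ?_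
    filter_upwards [lift_ae (C ^ 0) u] with t h1
    rw [h1]
    rfl
  | succ n ih =>
    rw [pow_succ (lift κ C)]
    change _ = (lift κ C ^ n) (lift κ C u)
    rw [← ih]
    refine L2w_ext ?_
    filter_upwards [lift_ae (C ^ (n + 1)) u, lift_ae (C ^ n) (lift κ C u), lift_ae C u]
      with t h1 h2 h3
    rw [h1, h2, h3, pow_succ]
    rfl

theorem mem_add_graph {E : Type*} [AddCommGroup E] [Module ℂ E] {f g : E →ₗ.[ℂ] E} {x y z : E}
    (hf : (x, y) ∈ f.graph) (hg : (x, z) ∈ g.graph) : (x, y + z) ∈ (f + g).graph := by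
  obtain ⟨a, ha, rfl⟩ := (LinearPMap.mem_graph_iff f).mp hf
  obtain ⟨b, hb, rfl⟩ := (LinearPMap.mem_graph_iff g).mp hg
  obtain rfl : (a : E) = x := ha
  have hag : (a : E) ∈ g.domain := (show (b : E) = a from hb) ▸ b.2
  obtain rfl : b = ⟨a, hag⟩ := Subtype.ext hb
  exact (LinearPMap.mem_graph_iff _).mpr ⟨⟨a, a.2, hag⟩, rfl, rfl⟩

theorem mem_neg_graph {E : Type*} [AddCommGroup E] [Module ℂ E] {f : E →ₗ.[ℂ] E} {x y : E}
    (hf : (x, y) ∈ f.graph) : (x, -y) ∈ (-f).graph := by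
  obtain ⟨a, rfl, rfl⟩ := (LinearPMap.mem_graph_iff f).mp hf
  exact (LinearPMap.mem_graph_iff _).mpr ⟨a, rfl, rfl⟩

theorem mem_P0_graph {y0 y1 y2 y3 f : L2w κ H}
    (h0 : (y0, y1) ∈ (weakDeriv κ H 1 + pointwiseOp κ A).graph)
    (h1 : (y1, y2) ∈ (weakDeriv κ H 1 + pointwiseOp κ A).graph)
    (h2 : (y2, y3) ∈ (weakDeriv κ H 1 + pointwiseOp κ A).graph)
    (h3 : (y3, f) ∈ (-weakDeriv κ H 1 + pointwiseOp κ A).graph) : (y0, f) ∈ (P0 A κ).graph := by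
  rw [P0, mem_opComp_graph]
  refine ⟨y3, ?_, h3⟩
  rw [opPow, mem_opComp_graph]
  refine ⟨y2, ?_, h2⟩
  rw [opPow, mem_opComp_graph]
  refine ⟨y1, ?_, h1⟩
  rw [opPow, mem_opComp_graph]
  exact ⟨y0, (LinearPMap.mem_graph_iff _).mpr ⟨⟨y0, trivial⟩, rfl, rfl⟩, h0⟩

end Graphs

variable [CompleteSpace H]

/-! ### The inverses of `d/dt + A` and `-d/dt + A` -/

/-- The inverse of `d/dt + A` with zero initial value. -/
theorem exists_forward {B J Q : H →L[ℂ] H} {m : ℝ} (h : IsPosInverse B J Q m) (hm : 0 < m)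
    (hκ : 0 < 2 * m + κ) :
    ∃ R S : L2w κ H →L[ℂ] L2w κ H, IsResolvent (lift κ B) R S ∧
      (∀ f, HasPrim (R f) (f - S f)) ∧
      ∀ y g a, HasPrim y g → y = lift κ B a → R (g + a) = y := by
  have hL := h.lift κ
  have hV := re_inner_volterra_nonneg (H := H) hκ
  obtain ⟨R, S, hR, hS⟩ := hL.exists_resolvent hm hV (lift_volterra hκ B) (lift_volterra hκ J)
    (lift_volterra hκ Q)
  have hprim : ∀ f, HasPrim (R f) (f - S f) := fun f => by
    have h1 := hasPrim_volterra hκ (f - S f + (m : ℂ) • R f)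
    rwa [← hR, add_sub_cancel_right] at h1
  have huniq : ∀ y g a, HasPrim y g → y = lift κ B a → R (g + a) = y := fun y g a hy ha => by
    have h1 := hL.resolvent_apply hm hV (lift_volterra hκ Q) (lift_volterra hκ B) hR hS
      (volterra_of_hasPrim hκ hy).symm ha
    rwa [add_sub_cancel_right] at h1
  refine ⟨R, S, ⟨hL.inj, hS, fun f => ?_⟩, hprim, huniq⟩
  -- B (R f) solves the equation with right-hand side B f, so uniqueness gives R B = B R; cancelling
  -- B then yields S B = R.
  have h1 := huniq _ _ _ ((hprim f).lift B) rfl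
  rw [map_sub, hS, sub_add_cancel] at h1
  refine sub_eq_zero.mp (hL.inj _ ?_)
  rw [map_sub, hS, h1, sub_self]

/-- The inverse of `-d/dt + A`. -/
theorem exists_backward {B J Q : H →L[ℂ] H} {m : ℝ} (h : IsPosInverse B J Q m) (hm : 0 < m)
    (hκ : 0 < 2 * (m - κ) + κ) :
    ∃ R S : L2w κ H →L[ℂ] L2w κ H, IsResolvent (lift κ B) R S ∧
      (∀ f, (R f, S f - f) ∈ weakDerivGraph κ H 1) ∧
      ∀ y g a, (y, g) ∈ weakDerivGraph κ H 1 → y = lift κ B a → R (a - g) = y := by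
  have hL := h.lift κ
  have hV := re_inner_antiVolterra_nonneg (H := H) hκ
  obtain ⟨R, S, hR, hS⟩ := hL.exists_resolvent hm hV (lift_antiVolterra hκ h.symm)
    (lift_antiVolterra hκ h.symmJ) (lift_antiVolterra hκ h.symmQ)
  have hder : ∀ f, (R f, S f - f) ∈ weakDerivGraph κ H 1 := fun f => by
    have h1 := antiVolterra_mem_weakDerivGraph hκ (f - S f + (m : ℂ) • R f)
    rw [← hR] at h1
    convert h1 using 2
    abel
  have huniq : ∀ y g a, (y, g) ∈ weakDerivGraph κ H 1 → y = lift κ B a → R (a - g) = y :=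
      fun y g a hy ha => by
    have h1 := hL.resolvent_apply hm hV (lift_antiVolterra hκ h.symmQ)
      (lift_antiVolterra hκ h.symm) hR hS (antiVolterra_of_weakDeriv hκ hy).symm ha
    rw [← h1]
    congr 1
    abel
  refine ⟨R, S, ⟨hL.inj, hS, fun f => ?_⟩, hder, huniq⟩
  -- As in the forward case, uniqueness gives R B = B R.
  have h1 := huniq _ _ _ (lift_mem_weakDerivGraph (hder f) B) rfl
  rw [map_sub (lift κ B), hS, sub_sub_cancel] at h1
  refine sub_eq_zero.mp (hL.inj _ ?_)
  rw [map_sub, hS, h1, sub_self]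

section Graphs

variable {A : H →ₗ.[ℂ] H} {B : H →L[ℂ] H}

theorem mem_deriv_add_graph (hB : ∀ x y, (x, y) ∈ A.graph ↔ x = B y) {y g a : L2w κ H}
    (hy : (y, g) ∈ weakDerivGraph κ H 1) (ha : y = lift κ B a) :
    (y, g + a) ∈ (weakDeriv κ H 1 + pointwiseOp κ A).graph := by
  refine mem_add_graph ?_ ?_
  · rwa [weakDeriv_graph]
  · rw [pointwiseOp_graph]
    exact (mem_pointwiseGraph hB).mpr ha

theorem mem_neg_deriv_add_graph (hB : ∀ x y, (x, y) ∈ A.graph ↔ x = B y) {y g a : L2w κ H}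
    (hy : (y, g) ∈ weakDerivGraph κ H 1) (ha : y = lift κ B a) :
    (y, -g + a) ∈ (-weakDeriv κ H 1 + pointwiseOp κ A).graph := by
  refine mem_add_graph (mem_neg_graph ?_) ?_
  · rwa [weakDeriv_graph]
  · rw [pointwiseOp_graph]
    exact (mem_pointwiseGraph hB).mpr ha

end Graphs

end

section

variable {H : Type*} [NormedAddCommGroup H] [InnerProductSpace ℂ H] {κ : ℝ}

/-! ### Continuity of the components of the norm of `W⁴_{2,κ}` -/

namespace W4

variable {A : H →ₗ.[ℂ] H}

theorem ext_toL2 {u v : W4 A κ} (h : toL2 u = toL2 v) : u = v :=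
  Subtype.ext h

theorem norm_d4_le (u : W4 A κ) : ‖d4 u‖ ≤ ‖u‖ := by
  rw [norm_eq]
  exact Real.le_sqrt_of_sq_le (by nlinarith [sq_nonneg ‖a4 u‖])

theorem norm_a4_le (u : W4 A κ) : ‖a4 u‖ ≤ ‖u‖ := by
  rw [norm_eq]
  exact Real.le_sqrt_of_sq_le (by nlinarith [sq_nonneg ‖d4 u‖])

theorem norm_le (u : W4 A κ) : ‖u‖ ≤ ‖d4 u‖ + ‖a4 u‖ := by
  rw [norm_eq]
  exact Real.sqrt_le_iff.mpr ⟨by positivity, by nlinarith [norm_nonneg (d4 u), norm_nonneg (a4 u)]⟩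

/-- The fourth derivative as a bounded operator. -/
def d4L : W4 A κ →L[ℂ] L2w κ H := d4.mkContinuous 1 fun u => by rw [one_mul]; exact norm_d4_le u

/-- The operator `u ↦ A⁴ u` as a bounded operator. -/
def a4L : W4 A κ →L[ℂ] L2w κ H := a4.mkContinuous 1 fun u => by rw [one_mul]; exact norm_a4_le u

theorem mem_graph_a4 (u : W4 A κ) : (toL2 u, a4 u) ∈ pointwiseGraph κ (opPow A 4) := by
  rw [← pointwiseOp_graph]
  exact LinearPMap.mem_graph _ (Submodule.inclusion inf_le_right u)

variable [CompleteSpace H]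

theorem mem_graph_d4 (u : W4 A κ) : (toL2 u, d4 u) ∈ weakDerivGraph κ H 4 := by
  rw [← weakDeriv_graph]
  exact LinearPMap.mem_graph _ (Submodule.inclusion inf_le_left u)

/-- A linear map into `L_{2,κ}` with values in `W⁴_{2,κ}`, as a map into the latter space. -/
def codRestrict (T D C : L2w κ H →L[ℂ] L2w κ H) (hD : ∀ f, (T f, D f) ∈ weakDerivGraph κ H 4)
    (hC : ∀ f, (T f, C f) ∈ pointwiseGraph κ (opPow A 4)) : L2w κ H →ₗ[ℂ] W4 A κ :=
  LinearMap.codRestrict ((weakDeriv κ H 4).domain ⊓ (pointwiseOp κ (opPow A 4)).domain)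
    T.toLinearMap fun f =>
      ⟨LinearPMap.mem_domain_of_mem_graph (y := D f) (by rw [weakDeriv_graph]; exact hD f),
        LinearPMap.mem_domain_of_mem_graph (y := C f) (by rw [pointwiseOp_graph]; exact hC f)⟩

variable {T D C : L2w κ H →L[ℂ] L2w κ H} (hD : ∀ f, (T f, D f) ∈ weakDerivGraph κ H 4)
  (hC : ∀ f, (T f, C f) ∈ pointwiseGraph κ (opPow A 4))

theorem d4_codRestrict (f : L2w κ H) : d4 (codRestrict T D C hD hC f) = D f := by
  have h1 := mem_graph_d4 (codRestrict T D C hD hC f)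
  have h2 := hD f
  rw [← weakDeriv_graph] at h1 h2
  exact (weakDeriv κ H 4).mem_graph_snd_inj h1 h2 rfl

theorem a4_codRestrict (f : L2w κ H) : a4 (codRestrict T D C hD hC f) = C f := by
  have h1 := mem_graph_a4 (codRestrict T D C hD hC f)
  have h2 := hC f
  rw [← pointwiseOp_graph] at h1 h2
  exact (pointwiseOp κ (opPow A 4)).mem_graph_snd_inj h1 h2 rfl

end W4

variable [CompleteSpace H]

/-! ### Intermediate derivatives -/

/-- If `u` and its fourth weak derivative are in `L_{2,κ}`, then so are the lower derivatives. -/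
theorem exists_weakDeriv_chain {m : ℝ} (hm : 0 < 2 * (m - κ) + κ) {u g : L2w κ H}
    (h : (u, g) ∈ weakDerivGraph κ H 4) :
    ∃ u1 u2 u3 : L2w κ H, (u, u1) ∈ weakDerivGraph κ H 1 ∧ (u1, u2) ∈ weakDerivGraph κ H 1 ∧
      (u2, u3) ∈ weakDerivGraph κ H 1 ∧ (u3, g) ∈ weakDerivGraph κ H 1 := by
  set V : L2w κ H →L[ℂ] L2w κ H := antiVolterra m hm with hV
  -- The Bezout identity with the scalar m in the role of A: S = m V and S⁴ u = V⁴ (m⁴ u). Once u =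
  -- V⁴ v, each derivative replaces one V by X = m V - 1.
  have hu := eq_pow_apply (R := V) (S := (m : ℂ) • V) ((Commute.refl V).smul_right (m : ℂ))
    (a := ((m : ℂ) ^ 4) • u) (antiVolterra_pow_weakDeriv hm h) (by
      rw [smul_pow, map_smul]; rfl)
  set v := coeffA ((m : ℂ) • V) (((m : ℂ) ^ 4) • u) + coeffD ((m : ℂ) • V) g
  set X : L2w κ H →L[ℂ] L2w κ H := (m : ℂ) • V - 1 with hX
  have hVX : ∀ w, (V w, X w) ∈ weakDerivGraph κ H 1 := antiVolterra_mem_weakDerivGraph hm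
  have hcomm : ∀ w, X (V w) = V (X w) := fun w => by
    change (m : ℂ) • V (V w) - V w = V ((m : ℂ) • V w - w)
    rw [map_sub, map_smul]
  have hu' : u = V (V (V (V v))) := hu
  have h1 : (u, V (X (V (V v)))) ∈ weakDerivGraph κ H 1 := by
    rw [hu', ← hcomm]; exact hVX _
  have h2 : (V (X (V (V v))), V (X (X (V v)))) ∈ weakDerivGraph κ H 1 := by
    have e : V (X (X (V v))) = X (X (V (V v))) := by rw [hcomm (V v), hcomm (X (V v))]
    rw [e]; exact hVX _
  have h3 : (V (X (X (V v))), V (X (X (X v)))) ∈ weakDerivGraph κ H 1 := by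
    have e : V (X (X (X v))) = X (X (X (V v))) := by
      rw [hcomm v, hcomm (X v), hcomm (X (X v))]
    rw [e]; exact hVX _
  have h4 : (V (X (X (X v))), X (X (X (X v)))) ∈ weakDerivGraph κ H 1 := hVX _
  -- The chain ends in some fourth weak derivative of u, which must be g by uniqueness.
  have h5 := mem_weakDerivGraph_succ h1 (mem_weakDerivGraph_succ h2 (mem_weakDerivGraph_succ h3 h4))
  rw [← weakDeriv_graph] at h h5
  rw [(weakDeriv κ H 4).mem_graph_snd_inj h5 h rfl] at h4
  exact ⟨_, _, _, h1, h2, h3, h4⟩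

/-- This is R d/dt = S - 1. As v need not take values in the domain of A, uniqueness is applied to B
v and the injective B is cancelled afterwards. -/
theorem resolvent_weakDeriv {B : H →L[ℂ] H} {R S : L2w κ H →L[ℂ] L2w κ H}
    (hr : IsResolvent (lift κ B) R S)
    (hu : ∀ y g a, (y, g) ∈ weakDerivGraph κ H 1 → y = lift κ B a → R (a - g) = y)
    {v w : L2w κ H} (h : (v, w) ∈ weakDerivGraph κ H 1) :
    R w = S v - v := by
  have h1 := hu _ _ _ (lift_mem_weakDerivGraph h B) rfl
  refine hr.eq_of_apply_eq ?_
  rw [map_sub R, hr.comm_B] at h1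
  rw [map_sub, hr.left, ← h1]
  abel

/-- Every element of `W⁴_{2,κ}` is in the range of `(-d/dt + A)⁻⁴`. -/
theorem eq_resolvent_pow_apply {B : H →L[ℂ] H} {R S : L2w κ H →L[ℂ] L2w κ H}
    (hr : IsResolvent (lift κ B) R S)
    (hu : ∀ y g a, (y, g) ∈ weakDerivGraph κ H 1 → y = lift κ B a → R (a - g) = y)
    {m : ℝ} (hm : 0 < 2 * (m - κ) + κ) {u g a : L2w κ H}
    (hg : (u, g) ∈ weakDerivGraph κ H 4) (ha : u = lift κ (B ^ 4) a) :
    u = R (R (R (R (coeffA S a + coeffD S g)))) := by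
  obtain ⟨u1, u2, u3, h1, h2, h3, h4⟩ := exists_weakDeriv_chain hm hg
  have e1 := resolvent_weakDeriv hr hu h1
  have e2 := resolvent_weakDeriv hr hu h2
  have e3 := resolvent_weakDeriv hr hu h3
  have e4 := resolvent_weakDeriv hr hu h4
  set D : L2w κ H →L[ℂ] L2w κ H := S - 1 with hD
  have hDR : ∀ x, R (D x) = D (R x) := fun x => by
    change R (S x - x) = S (R x) - R x
    rw [map_sub, hr.comm]
  have hc : Commute R S := ContinuousLinearMap.ext fun x => (hr.comm x).symm
  refine eq_pow_apply hc ?_ ?_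
  · change R (R (R (R g))) = D (D (D (D u)))
    rw [e4]
    change R (R (R (D u3))) = _
    rw [hDR, hDR, hDR, e3]
    change D (R (R (D u2))) = _
    rw [hDR, hDR, e2]
    change D (D (R (D u1))) = _
    rw [hDR, e1]
    rfl
  · rw [ha, lift_pow]
    change S (S (S (S (lift κ B (lift κ B (lift κ B (lift κ B a))))))) = R (R (R (R a)))
    rw [hr.right, hr.comm, hr.comm, hr.comm, hr.right, hr.comm, hr.comm, hr.right, hr.comm,
      hr.right]

end

section

variable {H : Type*} [NormedAddCommGroup H] [InnerProductSpace ℂ H] [CompleteSpace H] {κ : ℝ}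

/-! ### The operator `P₀` and its inverse -/

/-- On the range of R one has (d/dt + A) R = Z and (-d/dt + A) R = 1. Since Z commutes with R, each
factor d/dt + A uses up one R and leaves the next function in the range of R, so all four factors
apply. -/
theorem mem_P0_graph_backward {A : H →ₗ.[ℂ] H} {B : H →L[ℂ] H}
    (hB : ∀ x y, (x, y) ∈ A.graph ↔ x = B y) {R S Z : L2w κ H →L[ℂ] L2w κ H}
    (hr : IsResolvent (lift κ B) R S) (hd : ∀ f, (R f, S f - f) ∈ weakDerivGraph κ H 1)
    (hZ : ∀ x, Z x = (S x - x) + S x) (v : L2w κ H) :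
    (R (R (R (R v))), Z (Z (Z v))) ∈ (P0 A κ).graph := by
  have h1 : ∀ w, (R w, Z w) ∈ (weakDeriv κ H 1 + pointwiseOp κ A).graph := fun w => by
    rw [hZ]
    exact mem_deriv_add_graph hB (hd w) (hr.left w).symm
  have hc : ∀ w, R (Z w) = Z (R w) := fun w => by
    rw [hZ, hZ, hr.comm, map_add, map_sub]
  have h2 : ∀ w, (R w, w) ∈ (-weakDeriv κ H 1 + pointwiseOp κ A).graph := fun w => by
    have h := mem_neg_deriv_add_graph hB (hd w) (hr.left w).symm
    rwa [neg_sub, sub_add_cancel] at h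
  refine mem_P0_graph (y1 := R (Z (R (R v)))) (y2 := R (Z (Z (R v)))) (y3 := R (Z (Z (Z v))))
    ?_ ?_ ?_ (h2 _)
  · rw [hc]; exact h1 _
  · have e : R (Z (Z (R v))) = Z (Z (R (R v))) := by rw [hc, hc]
    rw [e]; exact h1 _
  · have e : R (Z (Z (Z v))) = Z (Z (Z (R v))) := by rw [hc, hc, hc]
    rw [e]; exact h1 _

/-- An element of the kernel of `P₀` that vanishes to second order at `0` is zero. -/
theorem eq_zero_of_P0_eq_zero {B : H →L[ℂ] H} (hinj : ∀ x, B x = 0 → x = 0)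
    {R S Z R' : L2w κ H →L[ℂ] L2w κ H} (hr : IsResolvent (lift κ B) R S)
    (hd : ∀ f, (R f, S f - f) ∈ weakDerivGraph κ H 1)
    (hZ : ∀ x, Z x = (S x - x) + S x)
    (hR' : ∀ y g a, HasPrim y g → y = lift κ B a → R' (g + a) = y) {v : L2w κ H}
    (hv : Z (Z (Z v)) = 0) {w : ℝ → H}
    (hw : ∀ᵐ t ∂volume.restrict (Ioi (0 : ℝ)), R (R (R (R v))) t = w t)
    (hc : ContDiffOn ℝ 2 w (Ici 0))
    (h0 : ∀ s : ℕ, s ≤ 2 → iteratedDerivWithin s w (Ici 0) 0 = 0) : R (R (R (R v))) = 0 := by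
  set D : L2w κ H →L[ℂ] L2w κ H := S - 1 with hD
  have hDx : ∀ x, D x = S x - x := fun x => rfl
  have hDR : ∀ x, D (R x) = R (D x) := fun x => by rw [hDx, hDx, map_sub, hr.comm]
  have hSR := hr.comm
  have hZD : ∀ x, Z x = D x + S x := hZ
  have hDS : ∀ x, S (D x) = D (S x) := fun x => by rw [hDx, hDx, map_sub]
  have hcan : ∀ x y, HasPrim (R x) (R y) → HasPrim (S x) (S y) := fun x y h => by
    refine HasPrim.of_lift hinj ?_
    rwa [hr.left, hr.left]
  have hd1 : (R (R (R (R v))), R (R (R (D v)))) ∈ weakDerivGraph κ H 1 := by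
    have h := hd (R (R (R v)))
    rwa [← hDx, hDR, hDR, hDR] at h
  have hd2 : (R (R (R (D v))), R (R (D (D v)))) ∈ weakDerivGraph κ H 1 := by
    have h := hd (R (R (D v)))
    rwa [← hDx, hDR, hDR] at h
  have hd3 : (R (R (D (D v))), R (D (D (D v)))) ∈ weakDerivGraph κ H 1 := by
    have h := hd (R (D (D v)))
    rwa [← hDx, hDR] at h
  obtain ⟨p0, p1, p2⟩ := hasPrim_of_contDiffOn hd1 hd2 hd3 hw hc h0
  -- The functions (d/dt + A) u and (d/dt + A)² u also contain A u, A u' and A² u; their primitive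
  -- relations follow from those of u and u' by applying A.
  have q0 : HasPrim (R (R (R (S v)))) (R (R (S (D v)))) := by
    have h := hcan _ _ p0
    rwa [hSR, hSR, hSR, hSR, hSR] at h
  have q1 : HasPrim (R (R (S (D v)))) (R (S (D (D v)))) := by
    have h := hcan _ _ p1
    rwa [hSR, hSR, hSR] at h
  have q2 : HasPrim (R (R (S (S v)))) (R (S (S (D v)))) := by
    have h := hcan _ _ q0
    rwa [hSR, hSR, hSR] at h
  have hB : ∀ x, R x = lift κ B (S x) := fun x => (hr.left x).symm
  -- With u = R⁴ v, the functions R³ Z v, R² Z² v and R Z³ v are (d/dt + A)ᵏ u for k = 1, 2, 3; R'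
  -- undoes each step, and the last function is R (Z³ v) = 0.
  have s0 : R' (R (R (R (Z v)))) = R (R (R (R v))) := by
    have h := hR' _ _ _ p0 (hB _)
    rwa [hSR, hSR, hSR, ← map_add, ← map_add, ← map_add, ← hZD] at h
  have s1 : R' (R (R (Z (Z v)))) = R (R (R (Z v))) := by
    have e : R (R (R (Z v))) = R (R (R (D v))) + R (R (R (S v))) := by
      rw [hZD, map_add, map_add, map_add]
    have h := hR' _ _ _ (p1.add q0) (e.symm.trans (hB _))
    rw [← e] at h
    refine Eq.trans (congrArg R' ?_) h
    simp only [hZD, map_add, hSR, hDS]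
  have s2 : R' (R (Z (Z (Z v)))) = R (R (Z (Z v))) := by
    have e : R (R (Z (Z v))) = R (R (D (D v))) + (R (R (S (D v))) + R (R (S (D v)))) +
        R (R (S (S v))) := by
      simp only [hZD, map_add, hDS]
      abel
    have h := hR' _ _ _ ((p2.add (q1.add q1)).add q2) (e.symm.trans (hB _))
    rw [← e] at h
    refine Eq.trans (congrArg R' ?_) h
    simp only [hZD, map_add, hSR, hDS]
    abel
  rw [hv, map_zero, map_zero] at s2
  rw [← s2, map_zero] at s1
  rw [← s1, map_zero] at s0
  exact s0.symm

/-- The properties of `u = (d/dt + A)⁻³ (-d/dt + A)⁻¹ f`. -/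
theorem exists_solution {A : H →ₗ.[ℂ] H} {B : H →L[ℂ] H}
    (hB : ∀ x y, (x, y) ∈ A.graph ↔ x = B y) {R S R' S' : L2w κ H →L[ℂ] L2w κ H}
    (hr : IsResolvent (lift κ B) R S) (hd : ∀ f, (R f, S f - f) ∈ weakDerivGraph κ H 1)
    (hr' : IsResolvent (lift κ B) R' S') (hd' : ∀ f, HasPrim (R' f) (f - S' f)) :
    ∃ T D C : L2w κ H →L[ℂ] L2w κ H, (∀ f, (T f, D f) ∈ weakDerivGraph κ H 4) ∧
      (∀ f, (T f, C f) ∈ pointwiseGraph κ (opPow A 4)) ∧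
      (∀ f, (T f, f) ∈ (P0 A κ).graph) ∧
      ∀ f, ∃ w : ℝ → H, w =ᵐ[wMeasure κ] T f ∧ ContDiffOn ℝ 2 w (Ici 0) ∧
        ∀ s : ℕ, s ≤ 2 → iteratedDerivWithin s w (Ici 0) 0 = 0 := by
  set N : L2w κ H →L[ℂ] L2w κ H := 1 - S' with hN
  have hNx : ∀ x, N x = x - S' x := fun x => rfl
  have hNR : ∀ x, N (R' x) = R' (N x) := fun x => by rw [hNx, hNx, map_sub, hr'.comm]
  have p : ∀ x, HasPrim (R' x) (N x) := hd'
  have p0 : ∀ f, HasPrim (R' (R' (R' (R f)))) (R' (R' (N (R f)))) := fun f => by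
    have h := p (R' (R' (R f)))
    rwa [hNR, hNR] at h
  have p1 : ∀ f, HasPrim (R' (R' (N (R f)))) (R' (N (N (R f)))) := fun f => by
    have h := p (R' (N (R f)))
    rwa [hNR] at h
  have p2 : ∀ f, HasPrim (R' (N (N (R f)))) (N (N (N (R f)))) := fun f => p _
  -- Here u''' = N³ R f, where R f need not vanish at 0. Expanding (1 - S')³ and using S' R = R' S
  -- gives N³ R = R - R' K, and both terms have a weak derivative in L_{2,κ}.
  let K : L2w κ H →L[ℂ] L2w κ H := (3 • (1 : L2w κ H →L[ℂ] L2w κ H) - 3 • S' + S' * S') * S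
  have hK : ∀ f, K f = (3 • S f - 3 • S' (S f)) + S' (S' (S f)) := fun f => rfl
  have hSR : ∀ f, S' (R f) = R' (S f) := fun f => by rw [← hr.left, hr'.right]
  have hNNN : ∀ f, N (N (N (R f))) = R f - R' (K f) := fun f => by
    simp only [hNx, hK, map_sub, map_add, map_nsmul, hSR, hr'.comm]
    abel
  have p3 : ∀ f, (N (N (N (R f))), (S f - f) - N (K f)) ∈ weakDerivGraph κ H 1 := fun f => by
    rw [hNNN]
    exact (weakDerivGraph κ H 1).sub_mem (hd f) (p (K f)).mem_weakDerivGraph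
  have hg : ∀ x, (R' x, x) ∈ (weakDeriv κ H 1 + pointwiseOp κ A).graph := fun x => by
    have h := mem_deriv_add_graph hB (hd' x).mem_weakDerivGraph (hr'.left x).symm
    rwa [sub_add_cancel] at h
  refine ⟨R' * R' * R' * R, S - 1 - N * K, S' * S' * S' * S, fun f => ?_, fun f => ?_, fun f => ?_,
    fun f => exists_contDiffOn_rep (p0 f) (p1 f) (p2 f)⟩
  · exact mem_weakDerivGraph_succ (p0 f).mem_weakDerivGraph (mem_weakDerivGraph_succ
      (p1 f).mem_weakDerivGraph (mem_weakDerivGraph_succ (p2 f).mem_weakDerivGraph (p3 f)))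
  · refine (mem_pointwiseGraph (mem_opPow_graph hB 4)).mpr ?_
    rw [lift_pow]
    change R' (R' (R' (R f))) = lift κ B (lift κ B (lift κ B (lift κ B (S' (S' (S' (S f)))))))
    simp only [hr'.left, ← hr'.comm_B, hr.left]
  · have h2 := mem_neg_deriv_add_graph hB (hd f) (hr.left f).symm
    rw [neg_sub, sub_add_cancel] at h2
    exact mem_P0_graph (hg _) (hg _) (hg _) h2

/-- A bounded operator inverse to an injective bounded part of `P₀` makes it an isomorphism. -/
theorem exists_equiv_of_inverse {A : H →ₗ.[ℂ] H} (P : W4 A κ →L[ℂ] L2w κ H)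
    (hgraph : ∀ u : W4 A κ, (W4.toL2 u, P u) ∈ (P0 A κ).graph)
    (hinj : ∀ u ∈ W40 A κ, P u = 0 → u = 0) {T D C : L2w κ H →L[ℂ] L2w κ H}
    (hD : ∀ f, (T f, D f) ∈ weakDerivGraph κ H 4)
    (hC : ∀ f, (T f, C f) ∈ pointwiseGraph κ (opPow A 4))
    (hT : ∀ f, (T f, f) ∈ (P0 A κ).graph)
    (hmem : ∀ f, W4.codRestrict T D C hD hC f ∈ W40 A κ) :
    ∃ P' : W40 A κ ≃L[ℂ] L2w κ H, ∀ u : W40 A κ, P' u = P u := by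
  let G : L2w κ H →L[ℂ] W4 A κ :=
    (W4.codRestrict T D C hD hC).mkContinuous (‖D‖ + ‖C‖) fun f => by
      refine (W4.norm_le (W4.codRestrict T D C hD hC f)).trans ?_
      rw [W4.d4_codRestrict, W4.a4_codRestrict, add_mul]
      exact add_le_add (D.le_opNorm f) (C.le_opNorm f)
  have hG : ∀ f, W4.toL2 (G f) = T f := fun f => rfl
  have hright : ∀ f, P (G f) = f := fun f =>
    (P0 A κ).mem_graph_snd_inj (hgraph (G f)) (hT f) (hG f)
  -- G (P u) - u lies in `W40 A κ` and is annihilated by P because G is a right inverse.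
  have hleft : ∀ u ∈ W40 A κ, G (P u) = u := fun u hu =>
    sub_eq_zero.mp (hinj _ ((W40 A κ).sub_mem (hmem _) hu) (by rw [map_sub, hright, sub_self]))
  exact ⟨ContinuousLinearEquiv.equivOfInverse (P ∘L (W40 A κ).subtypeL) (G.codRestrict (W40 A κ) hmem)
    (fun u => Subtype.ext (hleft u u.2)) hright, fun u => rfl⟩

/-- On all of `W⁴_{2,κ}` the operator `P₀` is defined and bounded. -/
theorem exists_bounded_P0 {A : H →ₗ.[ℂ] H} {B : H →L[ℂ] H}
    (hB : ∀ x y, (x, y) ∈ A.graph ↔ x = B y) {R S Z : L2w κ H →L[ℂ] L2w κ H}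
    (hr : IsResolvent (lift κ B) R S) (hd : ∀ f, (R f, S f - f) ∈ weakDerivGraph κ H 1)
    (hu : ∀ y g a, (y, g) ∈ weakDerivGraph κ H 1 → y = lift κ B a → R (a - g) = y)
    (hZ : ∀ x, Z x = (S x - x) + S x) {m : ℝ} (hm : 0 < 2 * (m - κ) + κ) :
    ∃ (P h : W4 A κ →L[ℂ] L2w κ H), (∀ u, P u = Z (Z (Z (h u)))) ∧
      (∀ u, W4.toL2 u = R (R (R (R (h u))))) ∧ ∀ u, (W4.toL2 u, P u) ∈ (P0 A κ).graph := by
  -- The Bezout coefficients are bounded and act on the two components of the norm of W⁴, so h, and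
  -- with it P = Z³ h, is bounded on W⁴.
  obtain ⟨h, hc⟩ : ∃ h : W4 A κ →L[ℂ] L2w κ H,
      ∀ u, h u = coeffA S (W4.a4 u) + coeffD S (W4.d4 u) :=
    ⟨(coeffA S).comp W4.a4L + (coeffD S).comp W4.d4L, fun u => rfl⟩
  have hh : ∀ u : W4 A κ, W4.toL2 u = R (R (R (R (h u)))) := fun u => by
    rw [hc]
    exact eq_resolvent_pow_apply hr hu hm (W4.mem_graph_d4 u)
      ((mem_pointwiseGraph (mem_opPow_graph hB 4)).mp (W4.mem_graph_a4 u))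
  refine ⟨Z ∘L Z ∘L Z ∘L h, h, fun u => rfl, hh, fun u => ?_⟩
  rw [hh]
  exact mem_P0_graph_backward hB hr hd hZ (h u)

end

end WeightedODE

/-! ### Assembly of the isomorphism. -/

theorem theorem1 {H : Type*} [NormedAddCommGroup H] [InnerProductSpace ℂ H] [CompleteSpace H]
    [TopologicalSpace.SeparableSpace H]
    (A : H →ₗ.[ℂ] H) (hA : IsSelfAdjoint A)
    (lam0 : ℝ) (hlam0 : 0 < lam0)
    (hA_ge : ∀ x : A.domain, lam0 * ‖(x : H)‖ ^ 2 ≤ (inner ℂ (A x) (x : H)).re)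
    (κ : ℝ) (hκ : |κ| < 2 * lam0) :
    ∃ P : WeightedODE.W40 A κ ≃L[ℂ] WeightedODE.L2w κ H,
      ∀ u : WeightedODE.W40 A κ,
        ∃ hu : WeightedODE.W4.toL2 (u : WeightedODE.W4 A κ) ∈ (WeightedODE.P0 A κ).domain,
          P u = WeightedODE.P0 A κ ⟨WeightedODE.W4.toL2 (u : WeightedODE.W4 A κ), hu⟩ := by
  open WeightedODE in
  obtain ⟨hκ1, hκ2⟩ := abs_lt.mp hκ
  obtain ⟨B, hB, hBs, hBi, hBp⟩ := exists_inverse A hA hlam0 hA_ge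
  obtain ⟨J, Q, hpos⟩ := exists_isPosInverse B hlam0 hBs hBi hBp
  -- The backward inverse needs κ < 2λ₀, the forward one needs -2λ₀ < κ.
  have hm : 0 < 2 * (lam0 - κ) + κ := by linarith
  obtain ⟨R, S, hr, hd, hu⟩ := exists_backward hpos hlam0 hm
  obtain ⟨R', S', hr', hd', hu'⟩ := exists_forward (κ := κ) hpos hlam0 (by linarith)
  obtain ⟨T, D, C, hD, hC, hP0, hrep⟩ := exists_solution hB hr hd hr' hd'
  have hZ : ∀ x, ((S - 1) + S) x = (S x - x) + S x := fun x => rfl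
  obtain ⟨P, h, hPh, hh, hgraph⟩ := exists_bounded_P0 hB hr hd hu hZ hm
  have hinj : ∀ u ∈ W40 A κ, P u = 0 → u = 0 := fun u hu0 hPu => by
    obtain ⟨w, hw, hwc, hw0⟩ := hu0
    rw [hh] at hw
    rw [hPh] at hPu
    have h1 := eq_zero_of_P0_eq_zero hBi hr hd hZ hu' hPu
      ((ae_wMeasure_iff κ).mp (hw.mono fun t ht => ht.symm)) hwc hw0
    rw [← hh] at h1
    exact W4.ext_toL2 (h1.trans (map_zero _).symm)
  obtain ⟨P', hP'⟩ := exists_equiv_of_inverse P hgraph hinj hD hC hP0 hrep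
  refine ⟨P', fun u => ?_⟩
  have hdom := LinearPMap.mem_domain_of_mem_graph (hgraph u)
  rw [hP']
  exact ⟨hdom, (P0 A κ).mem_graph_snd_inj (hgraph u) (LinearPMap.mem_graph _ ⟨_, hdom⟩) rfl⟩

end
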